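/- Let $k\ge 2$ and $M\ge 2k+1$ be integers and let $2\le d_1\le\dots\le d_k$ be integers with $d_1+\dots+d_k=M+k$. Let $f_1,\dots,f_k$ be non-zero homogeneous polynomials of degrees $d_1,\dots,d_k$ on $\mathbb P=\mathbb P^{M+k}_{\mathbb C}$ such that $F=\{f_1=\dots=f_k=0\}\subset\mathbb P$ is an irreducible reduced complete intersection of codimension $k$ (so $F$ is a Fano variety of index one and dimension $M$). Assume that $F$ is smooth and that every point $x\in F$ is regular in the following sense: in a standard affine chart $\mathbb C^{M+k}\subset\mathbb P$ with linear coordinates $z_*$ with origin at $x$, writing $f_i=q_{i,1}+\dots+q_{i,d_i}$ with $q_{i,j}$ homogeneous of degree $j$ in $z_*$, the system of equations $q_{i,j}=0$, $1\le i\le k$, $1\le j\le d_i$, $(i,j)\ne(k,d_k)$, defines a finite set of lines through the origin. Let $n\ge 0$ be an integer and let $\Sigma\subset|-nK_F|$ be a movable linear system, that is, a non-empty linear system without fixed components. Then for every irreducible subvariety $Y\subset F$ of dimension $k$, $$\mathop{\rm mult}\nolimits_Y\Sigma\le n,$$ where $\mathop{\rm mult}_Y\Sigma$ is the multiplicity along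 $Y$ of a general divisor $D\in\Sigma$, that is, the largest $m$ such that a local equation of $D$ at the generic point of $Y$ lies in the $m$-th power of the maximal ideal of the local ring $\mathcal O_{F,Y}$. -/

import Mathlib

open scoped LinearAlgebra.Projectivization

noncomputable section

/-- The polynomial ring `ℂ[x₀, …, x_N]`. -/
abbrev HomPoly (N : ℕ) : Type := MvPolynomial (Fin (N + 1)) ℂ

/-- Complex projective space `ℙ^N`, as a set of points. -/
abbrev PSpace (N : ℕ) : Type := ℙ ℂ (Fin (N + 1) → ℂ)

/-- The common zeros in `ℙ^N` of a set of (homogeneous) polynomials. -/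
def projZeros {N : ℕ} (T : Set (HomPoly N)) : Set (PSpace N) :=
  {p | ∀ g ∈ T, MvPolynomial.eval p.rep g = 0}

/-- Zariski closed subsets of `ℙ^N`. -/
def IsAlgebraicSet {N : ℕ} (Z : Set (PSpace N)) : Prop :=
  ∃ T : Set (HomPoly N), (∀ g ∈ T, ∃ m : ℕ, g.IsHomogeneous m) ∧ Z = projZeros T

/-- Irreducible Zariski closed subsets of `ℙ^N`. -/
structure ProjVariety (N : ℕ) where
  carrier : Set (PSpace N)
  isAlgebraicSet : IsAlgebraicSet carrier
  nonempty : carrier.Nonempty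
  irreducible : ∀ Z₁ Z₂ : Set (PSpace N), IsAlgebraicSet Z₁ → IsAlgebraicSet Z₂ →
    carrier ⊆ Z₁ ∪ Z₂ → carrier ⊆ Z₁ ∨ carrier ⊆ Z₂

/-- The punctured affine cone over a subset of `ℙ^N`. -/
def affineCone {N : ℕ} (Z : Set (PSpace N)) : Set (Fin (N + 1) → ℂ) :=
  {v | ∃ hv : v ≠ 0, Projectivization.mk ℂ v hv ∈ Z}

lemma smul_mem_affineCone {N : ℕ} {Z : Set (PSpace N)} {v : Fin (N + 1) → ℂ}
    (hv : v ∈ affineCone Z) {t : ℂ} (ht : t ≠ 0) : t • v ∈ affineCone Z := by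
  obtain ⟨h0, hZ⟩ := hv
  refine ⟨smul_ne_zero ht h0, ?_⟩
  have : Projectivization.mk ℂ (t • v) (smul_ne_zero ht h0) = Projectivization.mk ℂ v h0 := by
    rw [Projectivization.mk_eq_mk_iff']
    exact ⟨t, rfl⟩
  rwa [this]

lemma eval_smul_of_isHomogeneous {N m : ℕ} {g : HomPoly N} (hg : g.IsHomogeneous m) (t : ℂ)
    (v : Fin (N + 1) → ℂ) :
    MvPolynomial.eval (t • v) g = t ^ m * MvPolynomial.eval v g := by
  rw [MvPolynomial.eval_eq, MvPolynomial.eval_eq, Finset.mul_sum]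
  refine Finset.sum_congr rfl fun d hd => ?_
  have hdeg : ∑ i ∈ d.support, d i = m := by
    by_contra h
    exact MvPolynomial.mem_support_iff.mp hd (hg.coeff_eq_zero h)
  simp only [Pi.smul_apply, smul_eq_mul, mul_pow, Finset.prod_mul_distrib,
    Finset.prod_pow_eq_pow_sum, hdeg]
  ring

lemma rep_mem_affineCone {N : ℕ} {Z : Set (PSpace N)} {p : PSpace N} (hp : p ∈ Z) :
    p.rep ∈ affineCone Z :=
  ⟨p.rep_nonzero, by rwa [Projectivization.mk_rep]⟩

lemma eval_eq_zero_of_rep {N m : ℕ} {g : HomPoly N} (hg : g.IsHomogeneous m)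
    {v : Fin (N + 1) → ℂ} (hv : v ≠ 0)
    (h : MvPolynomial.eval (Projectivization.mk ℂ v hv).rep g = 0) :
    MvPolynomial.eval v g = 0 := by
  obtain ⟨a, ha⟩ := Projectivization.exists_smul_eq_mk_rep ℂ v hv
  rw [← ha, Units.smul_def, eval_smul_of_isHomogeneous hg] at h
  exact (mul_eq_zero.mp h).resolve_left (pow_ne_zero _ a.ne_zero)

/-- The `n`-th tensor power of the dual of `⋀^M Ω_{K/ℂ}`, for a field `K` over `ℂ`: the
`K`-multilinear functionals of `n` elements of `⋀^M Ω_{K/ℂ}`. -/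
def RatSections (K : Type) [Field K] [Algebra ℂ K] (M n : ℕ) : Type :=
  MultilinearMap K (fun _ : Fin n => ⋀[K]^M (Ω[K⁄ℂ])) K

instance RatSections.instAddCommGroup (K : Type) [Field K] [Algebra ℂ K] (M n : ℕ) :
    AddCommGroup (RatSections K M n) :=
  inferInstanceAs (AddCommGroup (MultilinearMap K (fun _ : Fin n => ⋀[K]^M (Ω[K⁄ℂ])) K))

instance RatSections.instModule (K : Type) [Field K] [Algebra ℂ K] (M n : ℕ) :
    Module ℂ (RatSections K M n) :=
  inferInstanceAs (Module ℂ (MultilinearMap K (fun _ : Fin n => ⋀[K]^M (Ω[K⁄ℂ])) K))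

/-- The value of `s` on the `n` forms `da_{j,1} ∧ ⋯ ∧ da_{j,M}`. -/
def RatSections.onWedges {K : Type} [Field K] [Algebra ℂ K] {M n : ℕ} (s : RatSections K M n)
    (a : Fin n → Fin M → K) : K :=
  let t : MultilinearMap K (fun _ : Fin n => ⋀[K]^M (Ω[K⁄ℂ])) K := s
  t fun j => exteriorPower.ιMulti K M fun i => KaehlerDifferential.D ℂ K (a j i)

lemma RatSections.onWedges_add {K : Type} [Field K] [Algebra ℂ K] {M n : ℕ}
    (s t : RatSections K M n) (a : Fin n → Fin M → K) :
    (s + t).onWedges a = s.onWedges a + t.onWedges a := rfl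

lemma RatSections.onWedges_zero {K : Type} [Field K] [Algebra ℂ K] {M n : ℕ}
    (a : Fin n → Fin M → K) : (0 : RatSections K M n).onWedges a = 0 := rfl

lemma RatSections.onWedges_smul {K : Type} [Field K] [Algebra ℂ K] {M n : ℕ} (c : ℂ)
    (s : RatSections K M n) (a : Fin n → Fin M → K) :
    (c • s).onWedges a = c • s.onWedges a := rfl

namespace ProjVariety

variable {N : ℕ}

/-- The homogeneous ideal of all polynomials vanishing on the variety. -/
def ideal (X : ProjVariety N) : Ideal (HomPoly N) :=
  MvPolynomial.vanishingIdeal ℂ (affineCone X.carrier)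

lemma mem_ideal {X : ProjVariety N} {g : HomPoly N} :
    g ∈ X.ideal ↔ ∀ v ∈ affineCone X.carrier, MvPolynomial.eval v g = 0 := by
  simp [ideal, MvPolynomial.aeval_eq_eval]

lemma homogeneousComponent_mem (X : ProjVariety N) {g : HomPoly N} (hg : g ∈ X.ideal) (m : ℕ) :
    MvPolynomial.homogeneousComponent m g ∈ X.ideal := by
  rw [mem_ideal] at hg ⊢
  intro v hv
  let q : Polynomial ℂ := ∑ i ∈ Finset.range (g.totalDegree + 1),
    Polynomial.C (MvPolynomial.eval v (MvPolynomial.homogeneousComponent i g)) * Polynomial.X ^ i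
  have hq : ∀ t : ℂ, t ≠ 0 → q.eval t = 0 := by
    intro t ht
    have h1 := hg _ (smul_mem_affineCone hv ht)
    rw [← MvPolynomial.sum_homogeneousComponent g, map_sum] at h1
    rw [← h1, Polynomial.eval_finsetSum]
    refine Finset.sum_congr rfl fun i _ => ?_
    rw [eval_smul_of_isHomogeneous (MvPolynomial.homogeneousComponent_isHomogeneous i g)]
    rw [Polynomial.eval_mul, Polynomial.eval_C, Polynomial.eval_pow, Polynomial.eval_X, mul_comm]
  have hq0 : q = 0 := by
    refine Polynomial.eq_zero_of_infinite_isRoot q ?_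
    refine Set.Infinite.mono (s := {0}ᶜ) (fun t ht => hq t ht) ?_
    exact (Set.finite_singleton (0 : ℂ)).infinite_compl
  by_cases hm : m < g.totalDegree + 1
  · have := congrArg (fun r => Polynomial.coeff r m) hq0
    simpa [q, Polynomial.finsetSum_coeff, Polynomial.coeff_C_mul, Polynomial.coeff_X_pow, hm,
      Nat.lt_succ_iff.mp hm] using this
  · rw [MvPolynomial.homogeneousComponent_eq_zero m g (by omega), map_zero]

lemma mem_or_mem_of_isHomogeneous (X : ProjVariety N) {a b : HomPoly N} {m n : ℕ}
    (ha : a.IsHomogeneous m) (hb : b.IsHomogeneous n) (hab : a * b ∈ X.ideal) :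
    a ∈ X.ideal ∨ b ∈ X.ideal := by
  have key : ∀ {c : HomPoly N} {l : ℕ}, c.IsHomogeneous l →
      X.carrier ⊆ projZeros {c} → c ∈ X.ideal := by
    intro c l hc hX
    rw [mem_ideal]
    rintro v ⟨hv, hvX⟩
    exact eval_eq_zero_of_rep hc hv (hX hvX c rfl)
  have halg : ∀ {c : HomPoly N} {l : ℕ}, c.IsHomogeneous l → IsAlgebraicSet (projZeros {c}) :=
    fun {c l} hc => ⟨{c}, by rintro g rfl; exact ⟨l, hc⟩, rfl⟩
  refine (X.irreducible _ _ (halg ha) (halg hb) ?_).imp (key ha) (key hb)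
  intro p hp
  have h := mem_ideal.mp hab _ (rep_mem_affineCone hp)
  rw [map_mul, mul_eq_zero] at h
  refine h.imp ?_ ?_ <;> · rintro h g rfl; exact h

instance isPrime_ideal (X : ProjVariety N) : X.ideal.IsPrime := by
  let _ := MvPolynomial.gradedAlgebra (σ := Fin (N + 1)) (R := ℂ)
  have hhom : X.ideal.IsHomogeneous (MvPolynomial.homogeneousSubmodule (Fin (N + 1)) ℂ) := by
    intro i g hg
    have h := X.homogeneousComponent_mem hg i
    rwa [← MvPolynomial.decomposition.decompose'_apply] at h
  refine hhom.isPrime_of_homogeneous_mem_or_mem ?_ ?_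
  · rw [Ne, Ideal.eq_top_iff_one, mem_ideal]
    obtain ⟨p, hp⟩ := X.nonempty
    intro h
    simpa using h _ (rep_mem_affineCone hp)
  · rintro a b ⟨m, ha⟩ ⟨n, hb⟩ hab
    exact X.mem_or_mem_of_isHomogeneous ha hb hab

/-- The homogeneous coordinate ring. -/
abbrev coordRing (X : ProjVariety N) : Type := HomPoly N ⧸ X.ideal

/-- `X` has dimension `r`: its homogeneous coordinate ring, that is the coordinate ring of the
affine cone over `X`, has Krull dimension `r + 1`. -/
def HasDim (X : ProjVariety N) (r : ℕ) : Prop :=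
  ringKrullDim X.coordRing = ((r + 1 : ℕ) : WithBot ℕ∞)

/-- The fraction field of the homogeneous coordinate ring. -/
abbrev coneField (X : ProjVariety N) : Type := FractionRing X.coordRing

/-- The class of a polynomial in `X.coneField`. -/
def toConeField (X : ProjVariety N) : HomPoly N →+* X.coneField :=
  (algebraMap X.coordRing X.coneField).comp (Ideal.Quotient.mk X.ideal)

lemma toConeField_eq_zero {X : ProjVariety N} {g : HomPoly N} :
    X.toConeField g = 0 ↔ g ∈ X.ideal := by
  rw [toConeField, RingHom.comp_apply, FaithfulSMul.algebraMap_eq_zero_iff,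
    Ideal.Quotient.eq_zero_iff_mem]

lemma toConeField_C (X : ProjVariety N) (c : ℂ) :
    X.toConeField (MvPolynomial.C c) = algebraMap ℂ X.coneField c := by
  rw [IsScalarTower.algebraMap_apply ℂ X.coordRing X.coneField]
  rfl

/-- The fractions `a / b` of forms of the same degree on `X` whose denominator vanishes identically
neither on `X` nor on `Y`. (For `Y ⊆ X` the first of these two conditions is implied by the
second.) -/
def fractionsAlong (X Y : ProjVariety N) : Subalgebra ℂ X.coneField where
  carrier := {q | ∃ (m : ℕ) (a b : HomPoly N), a.IsHomogeneous m ∧ b.IsHomogeneous m ∧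
    b ∉ X.ideal ∧ b ∉ Y.ideal ∧ q = X.toConeField a / X.toConeField b}
  mul_mem' := by
    rintro _ _ ⟨m, a, b, ha, hb, hX, hY, rfl⟩ ⟨m', a', b', ha', hb', hX', hY', rfl⟩
    refine ⟨m + m', a * a', b * b', ha.mul ha', hb.mul hb',
      X.isPrime_ideal.mul_notMem hX hX', Y.isPrime_ideal.mul_notMem hY hY', ?_⟩
    rw [map_mul, map_mul, div_mul_div_comm]
  add_mem' := by
    rintro _ _ ⟨m, a, b, ha, hb, hX, hY, rfl⟩ ⟨m', a', b', ha', hb', hX', hY', rfl⟩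
    refine ⟨m + m', a * b' + b * a', b * b', (ha.mul hb').add (hb.mul ha'), hb.mul hb',
      X.isPrime_ideal.mul_notMem hX hX', Y.isPrime_ideal.mul_notMem hY hY', ?_⟩
    rw [map_add, map_mul, map_mul, map_mul, div_add_div]
    · rwa [Ne, toConeField_eq_zero]
    · rwa [Ne, toConeField_eq_zero]
  algebraMap_mem' := fun c =>
    ⟨0, MvPolynomial.C c, 1, MvPolynomial.isHomogeneous_C _ _, MvPolynomial.isHomogeneous_one _ _,
      X.isPrime_ideal.one_notMem, Y.isPrime_ideal.one_notMem, by
        rw [map_one, div_one, toConeField_C]⟩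

/-- The field `ℂ(X)` of rational functions on `X`. -/
def functionField (X : ProjVariety N) : IntermediateField ℂ X.coneField where
  toSubalgebra := X.fractionsAlong X
  inv_mem' := by
    rintro _ ⟨m, a, b, ha, hb, hX, -, rfl⟩
    by_cases h : a ∈ X.ideal
    · rw [toConeField_eq_zero.mpr h, zero_div, inv_zero]
      exact (X.fractionsAlong X).zero_mem
    · exact ⟨m, b, a, hb, ha, h, h, inv_div _ _⟩

/-- The local ring `𝒪_{X,Y}` of `X` along an irreducible subvariety `Y ⊆ X`, inside `ℂ(X)`. -/
def localRing (X Y : ProjVariety N) : Subalgebra ℂ X.functionField :=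
  (X.fractionsAlong Y).comap X.functionField.val

/-- The maximal ideal of `𝒪_{X,Y}`: it consists of the fractions `a / b` whose numerator vanishes
on `Y` and whose denominator does not. -/
def maxIdealAlong (X Y : ProjVariety N) : Ideal (X.localRing Y) :=
  Ideal.span {q | ∃ (m : ℕ) (a b : HomPoly N), a.IsHomogeneous m ∧ b.IsHomogeneous m ∧
    a ∈ Y.ideal ∧ b ∉ X.ideal ∧ b ∉ Y.ideal ∧
    ((q : X.functionField) : X.coneField) = X.toConeField a / X.toConeField b}

/-- For `M = dim X`: the rational sections of the line bundle `ω_X^{⊗ (-n)}`. -/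
abbrev RatAnticanonical (X : ProjVariety N) (M n : ℕ) : Type :=
  RatSections X.functionField M n

/-- For `X` smooth of dimension `M`, the module `ω_{X,Y}` of regular `M`-forms along `Y` is generated
over `𝒪_{X,Y}` by the forms `da₁ ∧ ⋯ ∧ da_M` with `aᵢ ∈ 𝒪_{X,Y}`. The section `s` of `ω_X^{⊗ (-n)}`
vanishes along `Y` to order at least `m` when its values on all `n`-tuples of these lie in the
`m`-th power of the maximal ideal of `𝒪_{X,Y}`; equivalently, when a local equation of the divisor
of `s` at the generic point of `Y` lies there. For `m = 0` this says that `s` is regular at the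
generic point of `Y`. -/
def VanishesToOrder (X Y : ProjVariety N) {M n : ℕ} (s : X.RatAnticanonical M n) (m : ℕ) : Prop :=
  ∀ a : Fin n → Fin M → X.localRing Y, ∃ g ∈ X.maxIdealAlong Y ^ m,
    (g : X.functionField) = s.onWedges fun j i => (a j i : X.functionField)

/-- The space `H⁰(X, -nK_X)`, for `X` smooth of dimension `M`: the rational sections of
`ω_X^{⊗ (-n)}` that are regular at every (closed or not) point of `X`. -/
def anticanonicalSections (X : ProjVariety N) (M n : ℕ) :
    Submodule ℂ (X.RatAnticanonical M n) where
  carrier := {s | ∀ Y : ProjVariety N, Y.carrier ⊆ X.carrier → X.VanishesToOrder Y s 0}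
  add_mem' := by
    intro s t hs ht Y hY a
    obtain ⟨g, -, hg⟩ := hs Y hY a
    obtain ⟨h, -, hh⟩ := ht Y hY a
    exact ⟨g + h, by simp, by
      rw [RatSections.onWedges_add, ← hg, ← hh]; rfl⟩
  zero_mem' := fun Y _ a => ⟨0, by simp,
    (RatSections.onWedges_zero (M := M) (n := n) fun j i => (a j i : X.functionField)).symm⟩
  smul_mem' := by
    intro c s hs Y hY a
    obtain ⟨g, -, hg⟩ := hs Y hY a
    exact ⟨c • g, by simp, by
      rw [RatSections.onWedges_smul, ← hg]; rfl⟩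

/-- The multiplicity along `Y` of the divisor of a section (`⊤` for the zero section). -/
def multAlong (X Y : ProjVariety N) {M n : ℕ} (s : X.RatAnticanonical M n) : ℕ∞ :=
  ⨆ (m : ℕ) (_ : X.VanishesToOrder Y s m), (m : ℕ∞)

/-- The multiplicity `mult_Y Σ` of the linear system given by a space `V` of sections. It is the
minimum of the multiplicities of the members, which is the multiplicity of a general member. -/
def multSystem (X Y : ProjVariety N) {M n : ℕ} (V : Submodule ℂ (X.RatAnticanonical M n)) : ℕ∞ :=
  ⨅ s ∈ V, X.multAlong Y s

/-- Prime divisors on `X`. -/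
def IsPrimeDivisor (X Z : ProjVariety N) : Prop :=
  Z.carrier ⊆ X.carrier ∧ ∃ r : ℕ, Z.HasDim r ∧ X.HasDim (r + 1)

/-- `V` defines a non-empty linear subsystem of `|-nK_X|` without fixed components. -/
structure IsMovableSystem (X : ProjVariety N) (M n : ℕ)
    (V : Submodule ℂ (X.RatAnticanonical M n)) : Prop where
  le : V ≤ X.anticanonicalSections M n
  ne_bot : V ≠ ⊥
  no_fixed_component : ∀ Z : ProjVariety N, X.IsPrimeDivisor Z → X.multSystem Z V = 0

end ProjVariety

/-- The form `q_m` in the expansion `f (v + z) = q₀ + q₁(z) + q₂(z) + ⋯` of `f` at `v`. -/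
def taylorForm {N : ℕ} (f : HomPoly N) (v : Fin (N + 1) → ℂ) (m : ℕ) : HomPoly N :=
  MvPolynomial.homogeneousComponent m
    (MvPolynomial.aeval (fun l => MvPolynomial.C (v l) + MvPolynomial.X l) f)

/-- `x` is a regular point of `{f₁ = ⋯ = f_k = 0}`. The point `x = [v]`, `v_j = 1`, is taken as the
origin of the affine chart `{x_j ≠ 0}`, whose linear coordinates are the `z_l`, `l ≠ j`, so that
`z_j = 0` in the expansion `f_i (v + z) = q_{i,1}(z) + ⋯ + q_{i,d_i}(z)`. The equations
`q_{i,m} = 0` with `1 ≤ m ≤ d_i` and `(i, m) ≠ (k, d_k)` are required to define a finite set of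
lines through the origin. -/
def IsRegularPoint {N k : ℕ} (d : Fin k → ℕ) (f : Fin k → HomPoly N) (x : PSpace N) : Prop :=
  ∃ (j : Fin (N + 1)) (v : Fin (N + 1) → ℂ) (hv : v ≠ 0), Projectivization.mk ℂ v hv = x ∧
    v j = 1 ∧
    {p : PSpace N | p.rep j = 0 ∧ ∀ (i : Fin k) (m : ℕ), 1 ≤ m → m ≤ d i →
      ¬ ((i : ℕ) + 1 = k ∧ m = d i) →
      MvPolynomial.eval p.rep (taylorForm (f i) v m) = 0}.Finite

/-- `F` is an irreducible reduced complete intersection `{f₁ = ⋯ = f_k = 0}` of codimension `k` and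
type `(d₁, …, d_k)` in `ℙ^{M+k}`, where `d₁ + ⋯ + d_k = M + k`. -/
structure IsFanoCompleteIntersection (k M : ℕ) (d : Fin k → ℕ) (f : Fin k → HomPoly (M + k))
    (F : ProjVariety (M + k)) : Prop where
  two_le_degree : ∀ i, 2 ≤ d i
  monotone_degree : Monotone d
  sum_degree : ∑ i, d i = M + k
  ne_zero : ∀ i, f i ≠ 0
  isHomogeneous : ∀ i, (f i).IsHomogeneous (d i)
  carrier_eq : F.carrier = projZeros (Set.range f)
  hasDim : F.HasDim M
  /-- The scheme defined by the `f_i` is reduced: in each chart `{x_j ≠ 0}` its ideal is the ideal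
  of all functions vanishing on `F`. -/
  reduced : ∀ g ∈ F.ideal, ∀ j : Fin (M + k + 1), ∃ m : ℕ,
    MvPolynomial.X j ^ m * g ∈ Ideal.span (Set.range f)

/-- Jacobian criterion: the differentials of `f₁, …, f_k` are linearly independent at every common
zero. -/
def IsSmoothCI {N k : ℕ} (f : Fin k → HomPoly N) : Prop :=
  ∀ p ∈ projZeros (Set.range f), LinearIndependent ℂ
    (fun i : Fin k => fun l : Fin (N + 1) => MvPolynomial.eval p.rep (MvPolynomial.pderiv l (f i)))

end

/-! It is enough to bound the multiplicity of one nonzero section. Since the index is one, residues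
turn a section of $-nK_F$ into an element g of degree n of the function field of the affine cone
over F, regular away from the origin (`exists_form_of_section`). It must be shown that g cannot
vanish along Y to order m > n.

Geometrically, let p be a generic point of the ambient projective space and let R be the residual
curve to Y in the intersection of F with the cone over Y with vertex p. Both the degree of R and the
number of points of R on Y are deg Y · ∏(d_i − 1). A divisor of degree n with multiplicity m along Y
meets R in degree n · deg R and at least m · deg R, so m ≤ n unless it contains R; and these curves
sweep out F.

The formal argument replaces intersection numbers by pole orders. Let (x, y) be the generic point of
the product of the cones over F and Y, put p = x − y and let A = ℂ(p). Over A, the point y runs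
through the affine curve of those y on the cone over Y with y + p on the cone over F; its points at
infinity are those of Y where p is tangent to F. The filtration `degFil` by degree in y measures
poles at infinity. Taylor expansion at y shows that vanishing to order m lowers the degree of g by
m, up to a form Q that does not vanish on Y (`maxIdealAlong_pow_le_filIdeal`). If m > n,
multiplication by g strictly lowers degrees, so g and all y_i g preserve a finite-dimensional
A-space, and y is algebraic over A (`isAlgebraic_of_vanishing`). Then everything is algebraic over
the M + k + 1 coordinates of p, although the product of the cones has dimension M + k + 2
(`le_of_mul_mem_degFil`).

Three facts about p are needed. Its coordinates are independent, because every direction is tangent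
to F at some point of Y (`eq_zero_of_forall_eval_sub_eq_zero`). The form Q vanishes at no point at
infinity of the curve (`exists_mul_X_pow_mem_span_polarEquations`). The translated curve avoids the
origin, so g has bounded degree on it (`exists_sum_mul_eq_one`, `exists_forall_mul_mem_degFil`). -/

open MvPolynomial

/-! ### Krull dimension and transcendence degree of affine domains -/

section DimensionTheory

/-- Lying over lifts the first prime and going up lifts each further one. Control of the last term
is what keeps the induction running. -/
lemma exists_ltSeries_comap_of_isIntegral {R S : Type*} [CommRing R] [CommRing S] [Algebra R S]
    [Algebra.IsIntegral R S] (hinj : Function.Injective (algebraMap R S))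
    (l : LTSeries (PrimeSpectrum R)) :
    ∃ l' : LTSeries (PrimeSpectrum S), l'.length = l.length ∧
      PrimeSpectrum.comap (algebraMap R S) l'.last = l.last := by
  induction l using RelSeries.inductionOn' with
  | singleton p =>
    obtain ⟨Q, -, hQ, hQP⟩ := Ideal.exists_ideal_over_prime_of_isIntegral (S := S) p.asIdeal ⊥ (by
      rw [← RingHom.ker_eq_comap_bot, (RingHom.injective_iff_ker_eq_bot _).mp hinj]
      exact bot_le)
    exact ⟨RelSeries.singleton _ ⟨Q, hQ⟩, rfl, PrimeSpectrum.ext (by simpa using hQP)⟩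
  | snoc l p hp ih =>
    obtain ⟨l', hlen, hlast⟩ := ih
    have hle : l'.last.asIdeal.comap (algebraMap R S) ≤ p.asIdeal := by
      have h1 := congrArg PrimeSpectrum.asIdeal hlast
      rw [PrimeSpectrum.comap_asIdeal] at h1
      rw [h1]
      exact le_of_lt hp
    obtain ⟨Q, hle', hQ, hQP⟩ := Ideal.exists_ideal_over_prime_of_isIntegral (S := S) p.asIdeal
      l'.last.asIdeal hle
    have hne : l'.last ≠ ⟨Q, hQ⟩ := by
      intro h
      have h1 : l.last = p := by
        rw [← hlast, h]
        exact PrimeSpectrum.ext (by simpa using hQP)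
      have h2 : l.last < p := hp
      exact (h1 ▸ h2).ne rfl
    refine ⟨l'.snoc ⟨Q, hQ⟩ (lt_of_le_of_ne (show l'.last ≤ ⟨Q, hQ⟩ from hle') hne),
      by simp [hlen], ?_⟩
    rw [RelSeries.last_snoc, RelSeries.last_snoc]
    exact PrimeSpectrum.ext (by simpa using hQP)

/-- Incomparability makes contraction of primes strictly monotone, which bounds the dimension of
`S`; lifting chains gives the other inequality. -/
lemma ringKrullDim_eq_of_isIntegral {R S : Type*} [CommRing R] [CommRing S] [Algebra R S]
    [Algebra.IsIntegral R S] (hinj : Function.Injective (algebraMap R S)) :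
    ringKrullDim S = ringKrullDim R := by
  apply le_antisymm
  · refine Order.krullDim_le_of_strictMono (PrimeSpectrum.comap (algebraMap R S)) ?_
    intro p q hpq
    exact Ideal.IsIntegral.comap_lt_comap (R := R) (I := p.asIdeal) (J := q.asIdeal) hpq
  · refine iSup_le fun l => ?_
    obtain ⟨l', hlen, -⟩ := exists_ltSeries_comap_of_isIntegral hinj l
    rw [← hlen]
    exact le_iSup (fun p : LTSeries (PrimeSpectrum S) => (p.length : WithBot ℕ∞)) l'

/-- The dimension of an affine domain is its transcendence degree. -/
lemma exists_ringKrullDim_eq_trdeg_eq (k : Type) {A : Type} [Field k] [CommRing A] [IsDomain A]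
    [Algebra k A] [Algebra.FiniteType k A] :
    ∃ s : ℕ, ringKrullDim A = s ∧ Algebra.trdeg k A = s := by
  -- Noether normalization: both invariants equal the number of variables of a polynomial ring over
  -- which `A` is integral.
  obtain ⟨s, g, hinj, hint⟩ := exists_integral_inj_algHom_of_fg k A
  refine ⟨s, ?_, ?_⟩
  all_goals
    let _ := g.toRingHom.toAlgebra
    have hI : Algebra.IsIntegral (MvPolynomial (Fin s) k) A := ⟨hint⟩
  · rw [ringKrullDim_eq_of_isIntegral (R := MvPolynomial (Fin s) k) (S := A) hinj,
      MvPolynomial.ringKrullDim_of_isNoetherianRing, ringKrullDim_eq_zero_of_field]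
    simp
  · have : IsScalarTower k (MvPolynomial (Fin s) k) A :=
      IsScalarTower.of_algebraMap_eq fun c => (g.commutes c).symm
    have : FaithfulSMul (MvPolynomial (Fin s) k) A :=
      (faithfulSMul_iff_algebraMap_injective _ _).mpr hinj
    have := trdeg_add_eq k (MvPolynomial (Fin s) k) (A := A)
    rw [← this, trdeg_eq_zero (R := MvPolynomial (Fin s) k) (A := A)]
    simp

lemma trdeg_eq_of_ringKrullDim_eq (k : Type) {A : Type} [Field k] [CommRing A] [IsDomain A]
    [Algebra k A] [Algebra.FiniteType k A] {r : ℕ} (h : ringKrullDim A = r) :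
    Algebra.trdeg k A = r := by
  obtain ⟨s, h1, h2⟩ := exists_ringKrullDim_eq_trdeg_eq k (A := A)
  rw [h2]
  rw [h1] at h
  exact_mod_cast h

/-- A prime ideal strictly larger than another one defines a subvariety of smaller dimension. -/
lemma trdeg_quotient_le_of_lt (k : Type) {R : Type} [Field k] [CommRing R] [Algebra k R]
    [Algebra.FiniteType k R] {p q : Ideal R} [p.IsPrime] [q.IsPrime] (hpq : p < q) {r : ℕ}
    (h : ringKrullDim (R ⧸ p) = ((r + 1 : ℕ) : WithBot ℕ∞)) :
    Algebra.trdeg k (R ⧸ q) ≤ r := by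
  obtain ⟨s, h1, h2⟩ := exists_ringKrullDim_eq_trdeg_eq k (A := R ⧸ q)
  obtain ⟨a, haq, hap⟩ := SetLike.exists_of_lt hpq
  have ha0 : Ideal.Quotient.mk p a ≠ 0 := by rwa [Ne, Ideal.Quotient.eq_zero_iff_mem]
  -- The class of `a` is a non-zero-divisor of the domain `R ⧸ p` that dies in `R ⧸ q`, which costs
  -- at least one dimension.
  have h3 := ringKrullDim_succ_le_of_surjective (Ideal.Quotient.factor hpq.le)
    (Ideal.Quotient.factor_surjective hpq.le) (r := Ideal.Quotient.mk p a)
    (mem_nonZeroDivisors_of_ne_zero ha0)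
    (by rw [Ideal.Quotient.factor_mk]; exact Ideal.Quotient.eq_zero_iff_mem.mpr haq)
  rw [h1, h] at h3
  rw [h2]
  have : s + 1 ≤ r + 1 := by exact_mod_cast h3
  exact_mod_cast Nat.le_of_succ_le_succ this

end DimensionTheory

/-! ### Homogeneous components in ideals generated by forms -/

lemma MvPolynomial.IsHomogeneous.degree_eq {σ R : Type*} [CommSemiring R] {q : MvPolynomial σ R}
    {e : ℕ} (hq : q.IsHomogeneous e) {m : σ →₀ ℕ} (hm : m ∈ q.support) : m.degree = e := by
  by_contra h
  exact mem_support_iff.mp hm (hq.coeff_eq_zero h)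

/-- Homogeneous components of the elements of an ideal generated by homogeneous polynomials. -/
lemma map_homogeneousComponent_mem_of_mem_span {σ R Ω : Type*} [CommRing R] [AddCommGroup Ω]
    (ev : MvPolynomial σ R →+ Ω) (W : ℕ → AddSubgroup Ω) (G : Set (MvPolynomial σ R))
    (h : ∀ g ∈ G, ∃ d₀ : ℕ, g.IsHomogeneous d₀ ∧
      ∀ (d₁ : ℕ) (c : MvPolynomial σ R), c.IsHomogeneous d₁ → ev (c * g) ∈ W (d₁ + d₀))
    {p : MvPolynomial σ R} (hp : p ∈ Ideal.span G) (e : ℕ) :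
    ev (homogeneousComponent e p) ∈ W e := by
  induction hp using Submodule.closure_induction with
  | zero => simp
  | add x y _ _ hx hy => rw [map_add, map_add]; exact add_mem hx hy
  | smul_mem r g hg =>
    obtain ⟨d₀, hd, hW⟩ := h g hg
    -- Only the component of `r` of degree complementary to that of `g` contributes in degree `e`,
    -- so homogeneous coefficients suffice.
    rw [smul_eq_mul, ← sum_homogeneousComponent r, Finset.sum_mul, map_sum, map_sum]
    refine sum_mem fun i _ => ?_
    have hi := homogeneousComponent_isHomogeneous i r
    rw [homogeneousComponent_of_mem (hi.mul hd)]
    split_ifs with he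
    · rw [he]; exact hW i _ hi
    · simp

/-! ### The degree filtration and Taylor expansion -/

section DegreeFiltration

variable {ι A Ω : Type*} [CommRing A] [CommRing Ω] [Algebra A Ω]

/-- The span of the monomials of degree at most `e` in the elements `y i`. -/
def degFil (A : Type*) {ι Ω : Type*} [CommRing A] [CommRing Ω] [Algebra A Ω] (y : ι → Ω) (e : ℤ) :
    Submodule A Ω :=
  Submodule.span A {z | ∃ m : ι →₀ ℕ, (m.degree : ℤ) ≤ e ∧ z = m.prod fun i a => y i ^ a}

lemma degFil_mono (y : ι → Ω) {e e' : ℤ} (h : e ≤ e') : degFil A y e ≤ degFil A y e' :=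
  Submodule.span_mono fun _ ⟨m, hm, hz⟩ => ⟨m, hm.trans h, hz⟩

lemma monomial_mem_degFil (y : ι → Ω) (m : ι →₀ ℕ) {e : ℤ} (h : (m.degree : ℤ) ≤ e) :
    (m.prod fun i a => y i ^ a) ∈ degFil A y e :=
  Submodule.subset_span ⟨m, h, rfl⟩

/-- Degrees are integers so that this additivity survives subtraction; in negative degree the
filtration is zero. -/
lemma mul_mem_degFil {y : ι → Ω} {e e' : ℤ} {z w : Ω} (hz : z ∈ degFil A y e)
    (hw : w ∈ degFil A y e') : z * w ∈ degFil A y (e + e') := by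
  have h : degFil A y e * degFil A y e' ≤ degFil A y (e + e') := by
    rw [degFil, degFil, Submodule.span_mul_span, Submodule.span_le]
    rintro _ ⟨_, ⟨m, hm, rfl⟩, _, ⟨m', hm', rfl⟩, rfl⟩
    dsimp only
    rw [← Finsupp.prod_add_index' (fun _ => pow_zero _) (fun _ _ _ => pow_add _ _ _)]
    exact monomial_mem_degFil y _ (by rw [map_add]; push_cast; omega)
  exact h (Submodule.mul_mem_mul hz hw)

lemma mul_mem_degFil_of_eq {y : ι → Ω} {e e' e'' : ℤ} {z w : Ω} (hz : z ∈ degFil A y e)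
    (hw : w ∈ degFil A y e') (h : e + e' ≤ e'') : z * w ∈ degFil A y e'' :=
  degFil_mono y h (mul_mem_degFil hz hw)

lemma one_mem_degFil (y : ι → Ω) {e : ℤ} (he : 0 ≤ e) : (1 : Ω) ∈ degFil A y e := by
  simpa using monomial_mem_degFil (A := A) y 0 (e := e) (by simpa using he)

lemma algebraMap_mem_degFil (y : ι → Ω) (a : A) {e : ℤ} (he : 0 ≤ e) :
    algebraMap A Ω a ∈ degFil A y e := by
  rw [Algebra.algebraMap_eq_smul_one]
  exact Submodule.smul_mem _ _ (one_mem_degFil y he)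

lemma self_mem_degFil (y : ι → Ω) (i : ι) : y i ∈ degFil A y 1 := by
  simpa using monomial_mem_degFil (A := A) y (Finsupp.single i 1) (e := 1) (by simp)

lemma pow_mem_degFil {y : ι → Ω} {z : Ω} {e : ℤ} (hz : z ∈ degFil A y e) (n : ℕ) :
    z ^ n ∈ degFil A y (n * e) := by
  induction n with
  | zero => simpa using one_mem_degFil y le_rfl
  | succ n ih =>
    rw [pow_succ]
    exact mul_mem_degFil_of_eq ih hz (by push_cast; linarith)

lemma monomial_mem_degFil_of_mem {x y : ι → Ω} (h : ∀ i, x i ∈ degFil A y 1) (m : ι →₀ ℕ) :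
    (m.prod fun i a => x i ^ a) ∈ degFil A y m.degree := by
  induction m using Finsupp.induction_linear with
  | zero => simpa using one_mem_degFil y le_rfl
  | add f g hf hg =>
    rw [Finsupp.prod_add_index' (fun _ => pow_zero _) (fun _ _ _ => pow_add _ _ _), map_add]
    exact mul_mem_degFil_of_eq hf hg (by push_cast; rfl)
  | single a b =>
    rw [Finsupp.prod_single_index (h := fun i a => x i ^ a) (pow_zero _)]
    simpa using pow_mem_degFil (h a) b

lemma degFil_le_of_mem {x y : ι → Ω} (h : ∀ i, x i ∈ degFil A y 1) (e : ℤ) :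
    degFil A x e ≤ degFil A y e := by
  refine Submodule.span_le.mpr ?_
  rintro _ ⟨m, hm, rfl⟩
  exact degFil_mono y hm (monomial_mem_degFil_of_mem h m)

/-- There are finitely many monomials of bounded degree. Finite generation is what the determinant
trick requires later. -/
lemma fg_degFil [Finite ι] (y : ι → Ω) (e : ℤ) : (degFil A y e).FG := by
  refine Submodule.fg_span ?_
  refine ((Finsupp.finite_of_degree_le (σ := ι) e.toNat).image
    fun m => m.prod fun i a => y i ^ a).subset ?_
  rintro _ ⟨m, hm, rfl⟩
  exact ⟨m, by rw [Set.mem_ofPred_eq]; omega, rfl⟩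

lemma exists_mem_degFil_of_mem_adjoin {y : ι → Ω} {z : Ω}
    (hz : z ∈ Algebra.adjoin A (Set.range y)) : ∃ e : ℕ, z ∈ degFil A y e := by
  induction hz using Algebra.adjoin_induction with
  | mem z hz => obtain ⟨i, rfl⟩ := hz; exact ⟨1, by simpa using self_mem_degFil y i⟩
  | algebraMap a => exact ⟨0, algebraMap_mem_degFil y a le_rfl⟩
  | add z w _ _ hz hw =>
    obtain ⟨e, he⟩ := hz
    obtain ⟨e', he'⟩ := hw
    exact ⟨e + e', add_mem (degFil_mono y (by push_cast; omega) he)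
      (degFil_mono y (by push_cast; omega) he')⟩
  | mul z w _ _ hz hw =>
    obtain ⟨e, he⟩ := hz
    obtain ⟨e', he'⟩ := hw
    exact ⟨e + e', mul_mem_degFil_of_eq he he' (by push_cast; rfl)⟩

variable {R : Type*} [CommRing R] [Algebra R A] [Algebra R Ω] [IsScalarTower R A Ω]

lemma algebraMap_mem_degFil_of_tower (y : ι → Ω) (c : R) {e : ℤ} (he : 0 ≤ e) :
    algebraMap R Ω c ∈ degFil A y e := by
  rw [IsScalarTower.algebraMap_apply R A Ω]
  exact algebraMap_mem_degFil y _ he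

lemma aeval_mem_degFil {x y : ι → Ω} (h : ∀ i, x i ∈ degFil A y 1) {q : MvPolynomial ι R} {e : ℕ}
    (hq : q.IsHomogeneous e) : aeval x q ∈ degFil A y e := by
  rw [q.as_sum, map_sum]
  refine sum_mem fun m hm => ?_
  rw [aeval_monomial]
  refine mul_mem_degFil_of_eq (algebraMap_mem_degFil_of_tower y _ le_rfl)
    (monomial_mem_degFil_of_mem h m) ?_
  rw [hq.degree_eq hm, zero_add]

/-- First and second order Taylor expansion of forms at `y`, for the translated point
`x = y + p`. -/
lemma taylor_mem_degFil [Fintype ι] {x y : ι → Ω} {p : ι → A}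
    (hx : ∀ i, x i = y i + algebraMap A Ω (p i)) {q : MvPolynomial ι R} {e : ℕ}
    (hq : q.IsHomogeneous e) :
    aeval x q - aeval y q ∈ degFil A y (e - 1) ∧
    aeval x q - aeval y q - ∑ l, aeval y (pderiv l q) * algebraMap A Ω (p l)
      ∈ degFil A y (e - 2) := by
  classical
  have hx1 : ∀ i, x i ∈ degFil A y 1 := fun i => by
    rw [hx]
    exact add_mem (self_mem_degFil y i) (algebraMap_mem_degFil y _ zero_le_one)
  let D : MvPolynomial ι R → Ω := fun q => ∑ l, aeval y (pderiv l q) * algebraMap A Ω (p l)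
  have hDmul : ∀ q q' : MvPolynomial ι R, D (q * q') = D q * aeval y q' + aeval y q * D q' := by
    intro q q'
    simp only [D, Finset.sum_mul, Finset.mul_sum, ← Finset.sum_add_distrib]
    refine Finset.sum_congr rfl fun l _ => ?_
    rw [Derivation.leibniz, smul_eq_mul, smul_eq_mul, map_add, map_mul, map_mul]
    ring
  -- The remainders of a product involve the values, derivatives and lower remainders of both
  -- factors, so all bounds are carried together. Being closed under products, the property need
  -- only be checked on constants and variables.
  let Good : MvPolynomial ι R → ℤ → Prop := fun q e =>
    aeval y q ∈ degFil A y e ∧ aeval x q ∈ degFil A y e ∧ D q ∈ degFil A y (e - 1) ∧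
    aeval x q - aeval y q ∈ degFil A y (e - 1) ∧ aeval x q - aeval y q - D q ∈ degFil A y (e - 2)
  have hmul : ∀ q q' e e', Good q e → Good q' e' → Good (q * q') (e + e') := by
    rintro q q' e e' ⟨h1, h2, h3, h4, h5⟩ ⟨h1', h2', h3', h4', h5'⟩
    refine ⟨?_, ?_, ?_, ?_, ?_⟩
    · rw [map_mul]; exact mul_mem_degFil h1 h1'
    · rw [map_mul]; exact mul_mem_degFil h2 h2'
    · rw [hDmul]
      exact add_mem (mul_mem_degFil_of_eq h3 h1' (by linarith))
        (mul_mem_degFil_of_eq h1 h3' (by linarith))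
    · have : aeval x (q * q') - aeval y (q * q') =
          (aeval x q - aeval y q) * aeval x q' + aeval y q * (aeval x q' - aeval y q') := by
        rw [map_mul, map_mul]; ring
      rw [this]
      exact add_mem (mul_mem_degFil_of_eq h4 h2' (by linarith))
        (mul_mem_degFil_of_eq h1 h4' (by linarith))
    · have : aeval x (q * q') - aeval y (q * q') - D (q * q') =
          aeval y q * (aeval x q' - aeval y q' - D q') + D q * (aeval x q' - aeval y q') +
            (aeval x q - aeval y q - D q) * aeval x q' := by
        rw [map_mul, map_mul, hDmul]; ring
      rw [this]
      exact add_mem (add_mem (mul_mem_degFil_of_eq h1 h5' (by linarith))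
        (mul_mem_degFil_of_eq h3 h4' (by linarith))) (mul_mem_degFil_of_eq h5 h2' (by linarith))
  have hC : ∀ c : R, Good (C c) 0 := by
    intro c
    have hD : D (C c) = 0 := by simp [D]
    refine ⟨?_, ?_, ?_, ?_, ?_⟩
    · rw [← algebraMap_eq, AlgHom.commutes]
      exact algebraMap_mem_degFil_of_tower y c le_rfl
    · rw [← algebraMap_eq, AlgHom.commutes]
      exact algebraMap_mem_degFil_of_tower y c le_rfl
    · rw [hD]; exact zero_mem _
    · simp
    · rw [hD]; simp
  have hX : ∀ i : ι, Good (X i) 1 := by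
    intro i
    have hD : D (X i) = algebraMap A Ω (p i) := by
      simp only [D]
      rw [Finset.sum_eq_single i]
      · simp
      · intro l _ hl
        rw [pderiv_X_of_ne hl.symm, map_zero, zero_mul]
      · simp
    refine ⟨?_, ?_, ?_, ?_, ?_⟩
    · rw [aeval_X]; exact self_mem_degFil y i
    · rw [aeval_X]; exact hx1 i
    · rw [hD]; exact algebraMap_mem_degFil y _ (by norm_num)
    · rw [aeval_X, aeval_X, hx, add_sub_cancel_left]
      exact algebraMap_mem_degFil y _ (by norm_num)
    · rw [aeval_X, aeval_X, hx, hD, add_sub_cancel_left, sub_self]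
      exact zero_mem _
  have hmon : ∀ m : ι →₀ ℕ, Good (monomial m 1) m.degree := by
    intro m
    induction m using Finsupp.induction_linear with
    | zero => simpa using hC 1
    | add f g hf hg =>
      have := hmul _ _ _ _ hf hg
      rwa [monomial_mul, mul_one, ← Nat.cast_add, ← map_add] at this
    | single a b =>
      induction b with
      | zero => simpa using hC 1
      | succ b ih =>
        have := hmul _ _ _ _ ih (hX a)
        rw [X, monomial_mul, mul_one, ← Finsupp.single_add] at this
        simpa using this
  have hsum : Good q e := by
    have hcm : ∀ m ∈ q.support, Good (monomial m (coeff m q)) e := by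
      intro m hm
      have := hmul _ _ _ _ (hC (coeff m q)) (hmon m)
      rwa [C_mul_monomial, mul_one, zero_add, hq.degree_eq hm] at this
    have hDadd : ∀ s : Finset (ι →₀ ℕ), D (∑ m ∈ s, monomial m (coeff m q)) =
        ∑ m ∈ s, D (monomial m (coeff m q)) := by
      intro s
      simp only [D]
      rw [Finset.sum_comm]
      refine Finset.sum_congr rfl fun l _ => ?_
      rw [map_sum, map_sum, Finset.sum_mul]
    rw [q.as_sum]
    refine ⟨?_, ?_, ?_, ?_, ?_⟩
    · rw [map_sum]; exact sum_mem fun m hm => (hcm m hm).1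
    · rw [map_sum]; exact sum_mem fun m hm => (hcm m hm).2.1
    · rw [hDadd]; exact sum_mem fun m hm => (hcm m hm).2.2.1
    · rw [map_sum, map_sum, ← Finset.sum_sub_distrib]
      exact sum_mem fun m hm => (hcm m hm).2.2.2.1
    · rw [map_sum, map_sum, hDadd, ← Finset.sum_sub_distrib, ← Finset.sum_sub_distrib]
      exact sum_mem fun m hm => (hcm m hm).2.2.2.2
  exact ⟨hsum.2.2.2.1, hsum.2.2.2.2⟩

end DegreeFiltration

/-! ### Multiplication operators on the degree filtration -/

section Stability

lemma prod_eq_pow_mul_prod_sub {ι Ω : Type*} [CommRing Ω] (y : ι → Ω) {m : ι →₀ ℕ} {r : ℕ} {j : ι}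
    (h : r ≤ m j) :
    (m.prod fun i a => y i ^ a) =
      y j ^ r * ((m - Finsupp.single j r).prod fun i a => y i ^ a) ∧
    (m - Finsupp.single j r).degree + r = m.degree := by
  classical
  have hm : m = Finsupp.single j r + (m - Finsupp.single j r) := by
    rw [add_tsub_cancel_of_le]
    rwa [Finsupp.single_le_iff]
  constructor
  · conv_lhs => rw [hm]
    rw [Finsupp.prod_add_index' (fun _ => pow_zero _) (fun _ _ _ => pow_add _ _ _),
      Finsupp.prod_single_index (h := fun i a => y i ^ a) (pow_zero _)]
  · conv_rhs => rw [hm]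
    rw [map_add, Finsupp.degree_single, add_comm]

variable {ι A Ω : Type*} [Fintype ι]

lemma exists_le_apply_of_lt_degree {m : ι →₀ ℕ} {r : ℕ} (h : Fintype.card ι * r < m.degree) :
    ∃ j, r ≤ m j := by
  by_contra! hlt
  rw [Finsupp.degree_eq_sum] at h
  have : ∑ i, m i ≤ ∑ _i : ι, r := Finset.sum_le_sum fun i _ => (hlt i).le
  rw [Finset.sum_const, Finset.card_univ, smul_eq_mul] at this
  omega

variable [Field A] [Field Ω] [Algebra A Ω]

/-- A monomial of degree above `card ι * r` contains some `y j ^ r`, which can be traded for a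
multiple of `Q` plus terms of lower degree. Repeating this pushes the remainder down by `i`. The
hypothesis is the algebraic form of `Q` having no zero at infinity. -/
lemma degFil_le_map_sup {y : ι → Ω} {Q : Ω} {δ : ℤ} {r : ℕ}
    (h : ∀ j, y j ^ r ∈ (degFil A y (r - δ)).map (LinearMap.mulLeft A Q) ⊔ degFil A y (r - 1))
    (i : ℕ) {e : ℤ} (he : Fintype.card ι * r + i < e) :
    degFil A y e ≤ (degFil A y (e - δ)).map (LinearMap.mulLeft A Q) ⊔ degFil A y (e - i) := by
  have hstep : ∀ e : ℤ, Fintype.card ι * r < e →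
      degFil A y e ≤ (degFil A y (e - δ)).map (LinearMap.mulLeft A Q) ⊔ degFil A y (e - 1) := by
    intro e he
    refine Submodule.span_le.mpr ?_
    rintro _ ⟨m, hm, rfl⟩
    rcases hm.lt_or_eq with hlt | heq
    · exact Submodule.mem_sup_right (monomial_mem_degFil y m (by omega))
    · obtain ⟨j, hj⟩ := exists_le_apply_of_lt_degree (m := m) (r := r) (by
        rw [← heq] at he
        exact_mod_cast he)
      obtain ⟨h1, h2⟩ := prod_eq_pow_mul_prod_sub y hj
      have hrest := monomial_mem_degFil (A := A) y (m - Finsupp.single j r) le_rfl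
      rw [SetLike.mem_coe, h1]
      obtain ⟨_, ⟨c, hc, rfl⟩, w, hw, hcw⟩ := Submodule.mem_sup.mp (h j)
      rw [← hcw, add_mul]
      refine Submodule.add_mem_sup ⟨c * _, mul_mem_degFil_of_eq hc hrest (by omega), ?_⟩
        (mul_mem_degFil_of_eq hw hrest (by omega))
      simp only [LinearMap.mulLeft_apply]
      ring
  induction i with
  | zero => simp
  | succ i ih =>
    have h1 := ih (by push_cast at he; linarith)
    have h2 := hstep (e - i) (by push_cast at he; linarith)
    refine h1.trans (sup_le le_sup_left (h2.trans (sup_le_sup ?_ ?_)))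
    · exact Submodule.map_mono (degFil_mono y (by omega))
    · exact degFil_mono y (by push_cast; omega)

/-- If multiplication by `g` lowers the degree filtration, everything is algebraic. -/
lemma isAlgebraic_of_mul_mem_degFil {y : ι → Ω} {g : Ω} (hg : g ≠ 0) {e : ℤ} (he : 0 ≤ e)
    (h : ∀ z ∈ degFil A y e, g * z ∈ degFil A y (e - 1)) (i : ι) : IsAlgebraic A (y i) := by
  have hne : degFil A y e ≠ ⊥ := fun h0 => one_ne_zero
    ((Submodule.mem_bot A).mp (h0 ▸ one_mem_degFil (A := A) y he))
  -- Determinant trick: `g` and `y i * g` both preserve the nonzero finitely generated module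
  -- `degFil A y e`; the second does so because `g` lowers degrees by one. Their quotient `y i` is
  -- then algebraic.
  have h1 : IsIntegral A g := isIntegral_of_smul_mem_submodule (degFil A y e) hne (fg_degFil y e) g
    fun z hz => degFil_mono y (by omega) (h z hz)
  have h2 : IsIntegral A (y i * g) := isIntegral_of_smul_mem_submodule (degFil A y e) hne
    (fg_degFil y e) _ fun z hz => by
      rw [smul_eq_mul, mul_assoc]
      exact mul_mem_degFil_of_eq (self_mem_degFil y i) (h z hz) (by omega)
  have h3 : y i = (y i * g) * g⁻¹ := by field_simp
  rw [h3]
  exact h2.isAlgebraic.mul h1.isAlgebraic.inv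

/-- The filtration may be computed with `x` in place of `y`. A monomial in `x` of high degree
contains some `x j ^ s`, which absorbs the denominator of `g`. For the finitely many others, a
partition of unity in the `x i ^ s` bounds the degree uniformly, and this bound is harmless once `e`
is large. -/
lemma exists_forall_mul_mem_degFil {x y : ι → Ω} {p : ι → A}
    (hx : ∀ i, x i = y i + algebraMap A Ω (p i)) {g : Ω} {n s : ℕ}
    (hg : ∀ j, x j ^ s * g ∈ degFil A y (s + n))
    {c : ι → Ω} (hc : ∀ i, c i ∈ Algebra.adjoin A (Set.range y)) (hsum : ∑ i, x i * c i = 1) :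
    ∃ e₀ : ℤ, ∀ e ≥ e₀, ∀ z ∈ degFil A y e, g * z ∈ degFil A y (e + n) := by
  classical
  have hx1 : ∀ i, x i ∈ degFil A y 1 := fun i => by
    rw [hx]
    exact add_mem (self_mem_degFil y i) (algebraMap_mem_degFil y _ zero_le_one)
  have hy1 : ∀ i, y i ∈ degFil A x 1 := fun i => by
    rw [← sub_eq_iff_eq_add.mpr (hx i)]
    exact sub_mem (self_mem_degFil x i) (algebraMap_mem_degFil x _ zero_le_one)
  -- If the `x i` generate the unit ideal of `A[y]`, so do their `s`-th powers.
  have hpow : ∃ b : ι → Ω, (∀ i, b i ∈ Algebra.adjoin A (Set.range y)) ∧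
      ∑ i, x i ^ s * b i = 1 := by
    have hxa : ∀ i, x i ∈ Algebra.adjoin A (Set.range y) := fun i => by
      rw [hx]
      exact add_mem (Algebra.subset_adjoin ⟨i, rfl⟩) (Subalgebra.algebraMap_mem _ _)
    let x' : ι → Algebra.adjoin A (Set.range y) := fun i => ⟨x i, hxa i⟩
    have htop : Ideal.span (Set.range x') = ⊤ := by
      rw [Ideal.eq_top_iff_one, Ideal.mem_span_range_iff_exists_fun]
      refine ⟨fun i => ⟨c i, hc i⟩, Subtype.ext ?_⟩
      rw [AddSubmonoidClass.coe_finsetSum]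
      simpa [x', mul_comm] using hsum
    have htop' := Ideal.span_pow_eq_top _ htop s
    rw [← Set.range_comp, Ideal.eq_top_iff_one, Ideal.mem_span_range_iff_exists_fun] at htop'
    obtain ⟨b, hb⟩ := htop'
    refine ⟨fun i => b i, fun i => (b i).2, ?_⟩
    have := congrArg Subtype.val hb
    rw [AddSubmonoidClass.coe_finsetSum] at this
    simpa [x', mul_comm] using this
  obtain ⟨b, hb, hbsum⟩ := hpow
  choose E hE using fun i => exists_mem_degFil_of_mem_adjoin (hb i)
  -- The worst low-degree case: `s` from `x i ^ s * g`, `E i` from the coefficient `b i`, and `card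
  -- ι * s` from the monomial.
  refine ⟨s + ∑ i, E i + Fintype.card ι * s, fun e he => ?_⟩
  suffices hle : degFil A x e ≤ (degFil A y (e + n)).comap (LinearMap.mulLeft A g) from
    fun z hz => hle (degFil_le_of_mem hy1 e hz)
  refine Submodule.span_le.mpr ?_
  rintro _ ⟨m, hm, rfl⟩
  rw [SetLike.mem_coe, Submodule.mem_comap, LinearMap.mulLeft_apply]
  by_cases hdeg : Fintype.card ι * s < m.degree
  · obtain ⟨j, hj⟩ := exists_le_apply_of_lt_degree hdeg
    obtain ⟨h1, h2⟩ := prod_eq_pow_mul_prod_sub x hj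
    rw [h1, ← mul_assoc, mul_comm g]
    exact mul_mem_degFil_of_eq (hg j) (monomial_mem_degFil_of_mem hx1 _) (by omega)
  · have h1 : g * (m.prod fun i a => x i ^ a) =
        ∑ i, (x i ^ s * g) * (b i * m.prod fun i a => x i ^ a) := by
      rw [← one_mul (g * _), ← hbsum, Finset.sum_mul]
      exact Finset.sum_congr rfl fun i _ => by ring
    rw [h1]
    refine sum_mem fun i _ => mul_mem_degFil_of_eq (hg i) (mul_mem_degFil (hE i)
      (monomial_mem_degFil_of_mem hx1 m)) ?_
    have h2 : E i ≤ ∑ i, E i := Finset.single_le_sum (fun _ _ => Nat.zero_le _) (Finset.mem_univ i)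
    have h3 : (m.degree : ℤ) ≤ Fintype.card ι * s := by exact_mod_cast not_lt.mp hdeg
    have h4 : (E i : ℤ) ≤ ((∑ i, E i : ℕ) : ℤ) := by exact_mod_cast h2
    linarith

/-- A form `g` of degree `n` that vanishes to order `m > n` where `Q` does not vanish forces the
coordinates to be algebraic over the field of coefficients. -/
lemma isAlgebraic_of_vanishing {x y : ι → Ω} {p : ι → A}
    (hx : ∀ i, x i = y i + algebraMap A Ω (p i)) {g Q : Ω} (hg0 : g ≠ 0) {n m s r : ℕ} {δ : ℤ}
    (hnm : n < m) (hQg : Q * g ∈ degFil A y (δ + n - m))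
    (hQ : ∀ j, y j ^ r ∈ (degFil A y (r - δ)).map (LinearMap.mulLeft A Q) ⊔ degFil A y (r - 1))
    (hg : ∀ j, x j ^ s * g ∈ degFil A y (s + n))
    {c : ι → Ω} (hc : ∀ i, c i ∈ Algebra.adjoin A (Set.range y)) (hsum : ∑ i, x i * c i = 1)
    (i : ι) : IsAlgebraic A (y i) := by
  obtain ⟨e₀, he₀⟩ := exists_forall_mul_mem_degFil hx hg hc hsum
  have hpos : (0 : ℤ) ≤ Fintype.card ι * r := by positivity
  -- Large enough to lower the remainder `m` times modulo `Q`, and still to have `e - m ≥ e₀` for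
  -- the multiplication bound on that remainder.
  let e : ℤ := Fintype.card ι * r + m + 1 + |e₀|
  have habs := le_abs_self e₀
  have habs' := abs_nonneg e₀
  refine isAlgebraic_of_mul_mem_degFil hg0 (e := e) (by positivity) (fun z hz => ?_) i
  obtain ⟨_, ⟨c, hc, rfl⟩, w, hw, rfl⟩ := Submodule.mem_sup.mp
    (degFil_le_map_sup hQ m (e := e) (by simp only [e]; linarith) hz)
  -- Both summands land in degree at most `e + n - m ≤ e - 1`: the multiple of `Q` through the
  -- vanishing of `Q * g`, the remainder because it has already dropped by `m` while `g` adds only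
  -- `n`.
  rw [mul_add, LinearMap.mulLeft_apply, ← mul_assoc, mul_comm g Q]
  refine add_mem (mul_mem_degFil_of_eq hQg hc (by omega)) ?_
  exact degFil_mono y (by omega) (he₀ (e - m) (by simp only [e]; linarith) w hw)

end Stability

/-! ### The product of two affine cones and its generic point -/

lemma exists_algebraicIndependent_of_ringKrullDim {A : Type} [CommRing A] [IsDomain A]
    [Algebra ℂ A] [Algebra.FiniteType ℂ A] {r : ℕ} (h : ringKrullDim A = r) :
    ∃ b : Fin r → A, AlgebraicIndependent ℂ b := by
  obtain ⟨ι, b, hb⟩ := exists_isTranscendenceBasis' ℂ A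
  have h1 := hb.cardinalMk_eq_trdeg
  rw [trdeg_eq_of_ringKrullDim_eq ℂ h] at h1
  have h2 : Cardinal.mk ι = Cardinal.mk (Fin r) := by rw [h1, Cardinal.mk_fin]
  obtain ⟨e⟩ := Cardinal.eq.mp h2
  exact ⟨b ∘ e.symm, hb.1.comp _ e.symm.injective⟩

lemma eval_sumElim_eq_eval_map {S T : Type*} (u : S → ℂ) (w : T → ℂ)
    (R : MvPolynomial (S ⊕ T) ℂ) :
    eval (Sum.elim u w) R = eval u (map (eval w) (sumAlgEquiv ℂ S T R)) := by
  induction R using MvPolynomial.induction_on with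
  | C a => simp
  | add p q hp hq => simp only [map_add, hp, hq]
  | mul_X p i hp =>
    rw [map_mul, hp, map_mul, map_mul, map_mul]
    congr 1
    cases i <;> simp

namespace ProjVariety

noncomputable section

variable {N : ℕ}

/-- The ideal of the product of the affine cones over two projective varieties. -/
def prodIdeal (X Z : ProjVariety N) : Ideal (MvPolynomial (Fin (N + 1) ⊕ Fin (N + 1)) ℂ) :=
  vanishingIdeal ℂ {w | ∃ v ∈ affineCone X.carrier, ∃ v' ∈ affineCone Z.carrier, w = Sum.elim v v'}

lemma affineCone_nonempty (X : ProjVariety N) : (affineCone X.carrier).Nonempty :=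
  let ⟨_, hp⟩ := X.nonempty
  ⟨_, rep_mem_affineCone hp⟩

lemma mem_prodIdeal {X Z : ProjVariety N} {q : MvPolynomial (Fin (N + 1) ⊕ Fin (N + 1)) ℂ} :
    q ∈ X.prodIdeal Z ↔ ∀ v ∈ affineCone X.carrier, ∀ v' ∈ affineCone Z.carrier,
      eval (Sum.elim v v') q = 0 := by
  constructor
  · intro h v hv v' hv'
    have := mem_vanishingIdeal_iff.mp h _ ⟨v, hv, v', hv', rfl⟩
    rwa [aeval_eq_eval] at this
  · intro h
    refine mem_vanishingIdeal_iff.mpr ?_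
    rintro _ ⟨v, hv, v', hv', rfl⟩
    rw [aeval_eq_eval]
    exact h v hv v' hv'

/-- The restriction of a polynomial in two sets of variables to a fixed value of the first. -/
def fixLeft (v : Fin (N + 1) → ℂ) :
    MvPolynomial (Fin (N + 1) ⊕ Fin (N + 1)) ℂ →ₐ[ℂ] HomPoly N :=
  aeval (Sum.elim (fun i => C (v i)) X)

/-- The restriction of a polynomial in two sets of variables to a fixed value of the second. -/
def fixRight (v : Fin (N + 1) → ℂ) :
    MvPolynomial (Fin (N + 1) ⊕ Fin (N + 1)) ℂ →ₐ[ℂ] HomPoly N :=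
  aeval (Sum.elim X (fun i => C (v i)))

lemma eval_fixLeft (v w : Fin (N + 1) → ℂ) (q : MvPolynomial (Fin (N + 1) ⊕ Fin (N + 1)) ℂ) :
    eval w (fixLeft v q) = eval (Sum.elim v w) q := by
  induction q using MvPolynomial.induction_on with
  | C a => simp [fixLeft]
  | add p q hp hq => simp only [map_add, hp, hq]
  | mul_X p i hp =>
    rw [map_mul, map_mul, map_mul, hp]
    cases i <;> simp [fixLeft]

lemma eval_fixRight (v w : Fin (N + 1) → ℂ) (q : MvPolynomial (Fin (N + 1) ⊕ Fin (N + 1)) ℂ) :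
    eval w (fixRight v q) = eval (Sum.elim w v) q := by
  induction q using MvPolynomial.induction_on with
  | C a => simp [fixRight]
  | add p q hp hq => simp only [map_add, hp, hq]
  | mul_X p i hp =>
    rw [map_mul, map_mul, map_mul, hp]
    cases i <;> simp [fixRight]

/-- A product of irreducible sets is irreducible. Slices of `p` and `q` at suitable second
coordinates are nonzero on `X`, so some `v` is a non-zero of both. The slices at `v` are then
nonzero on `Z`, and so is their product. -/
instance isPrime_prodIdeal (X Z : ProjVariety N) : (X.prodIdeal Z).IsPrime := by
  constructor
  · rw [Ne, Ideal.eq_top_iff_one, mem_prodIdeal]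
    obtain ⟨v, hv⟩ := X.affineCone_nonempty
    obtain ⟨v', hv'⟩ := Z.affineCone_nonempty
    intro h
    simpa using h v hv v' hv'
  · intro p q hpq
    by_contra! hcon
    simp only [mem_prodIdeal, not_forall] at hcon
    obtain ⟨⟨v₀, hv₀, w₀, hw₀, h₀⟩, v₁, hv₁, w₁, hw₁, h₁⟩ := hcon
    have hp : fixRight w₀ p ∉ X.ideal := fun h => h₀ (by
      rw [← eval_fixRight]; exact mem_ideal.mp h v₀ hv₀)
    have hq : fixRight w₁ q ∉ X.ideal := fun h => h₁ (by
      rw [← eval_fixRight]; exact mem_ideal.mp h v₁ hv₁)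
    have hmul := X.isPrime_ideal.mul_notMem hp hq
    rw [mem_ideal] at hmul
    push Not at hmul
    obtain ⟨v, hv, hne⟩ := hmul
    rw [map_mul, mul_ne_zero_iff, eval_fixRight, eval_fixRight] at hne
    have hp' : fixLeft v p ∉ Z.ideal := fun h => hne.1 (by
      rw [← eval_fixLeft]; exact mem_ideal.mp h w₀ hw₀)
    have hq' : fixLeft v q ∉ Z.ideal := fun h => hne.2 (by
      rw [← eval_fixLeft]; exact mem_ideal.mp h w₁ hw₁)
    refine Z.isPrime_ideal.mul_notMem hp' hq' ?_
    rw [mem_ideal]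
    intro w hw
    rw [← map_mul, eval_fixLeft]
    exact mem_prodIdeal.mp hpq v hv w hw

/-- The function field of the product of the affine cones over two varieties. -/
abbrev prodField (X Z : ProjVariety N) : Type :=
  FractionRing (MvPolynomial (Fin (N + 1) ⊕ Fin (N + 1)) ℂ ⧸ X.prodIdeal Z)

/-- The generic point of the cone over the first factor. -/
def genFst (X Z : ProjVariety N) (i : Fin (N + 1)) : X.prodField Z :=
  algebraMap _ _ (Ideal.Quotient.mk (X.prodIdeal Z) (MvPolynomial.X (Sum.inl i)))

/-- The generic point of the cone over the second factor. -/
def genSnd (X Z : ProjVariety N) (i : Fin (N + 1)) : X.prodField Z :=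
  algebraMap _ _ (Ideal.Quotient.mk (X.prodIdeal Z) (MvPolynomial.X (Sum.inr i)))

lemma aeval_gen_eq (X Z : ProjVariety N) (q : MvPolynomial (Fin (N + 1) ⊕ Fin (N + 1)) ℂ) :
    aeval (Sum.elim (X.genFst Z) (X.genSnd Z)) q =
      algebraMap _ (X.prodField Z) (Ideal.Quotient.mk (X.prodIdeal Z) q) := by
  have h : aeval (Sum.elim (X.genFst Z) (X.genSnd Z)) =
      (IsScalarTower.toAlgHom ℂ (MvPolynomial (Fin (N + 1) ⊕ Fin (N + 1)) ℂ ⧸ X.prodIdeal Z)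
        (X.prodField Z)).comp (Ideal.Quotient.mkₐ ℂ (X.prodIdeal Z)) := by
    refine MvPolynomial.algHom_ext fun i => ?_
    rw [aeval_X]
    cases i <;> rfl
  rw [h]
  rfl

lemma aeval_gen_eq_zero {X Z : ProjVariety N} {q : MvPolynomial (Fin (N + 1) ⊕ Fin (N + 1)) ℂ} :
    aeval (Sum.elim (X.genFst Z) (X.genSnd Z)) q = 0 ↔
      ∀ v ∈ affineCone X.carrier, ∀ v' ∈ affineCone Z.carrier, eval (Sum.elim v v') q = 0 := by
  rw [aeval_gen_eq, FaithfulSMul.algebraMap_eq_zero_iff, Ideal.Quotient.eq_zero_iff_mem,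
    mem_prodIdeal]

lemma aeval_genFst_eq_zero {X Z : ProjVariety N} {q : HomPoly N} :
    aeval (X.genFst Z) q = 0 ↔ q ∈ X.ideal := by
  have h : aeval (X.genFst Z) q =
      aeval (Sum.elim (X.genFst Z) (X.genSnd Z)) (rename Sum.inl q) := by
    rw [aeval_rename, Sum.elim_comp_inl]
  obtain ⟨v', hv'⟩ := Z.affineCone_nonempty
  simp only [h, aeval_gen_eq_zero, mem_ideal, eval_rename, Sum.elim_comp_inl]
  exact ⟨fun h v hv => h v hv v' hv', fun h v hv _ _ => h v hv⟩

lemma aeval_genSnd_eq_zero {X Z : ProjVariety N} {q : HomPoly N} :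
    aeval (X.genSnd Z) q = 0 ↔ q ∈ Z.ideal := by
  have h : aeval (X.genSnd Z) q =
      aeval (Sum.elim (X.genFst Z) (X.genSnd Z)) (rename Sum.inr q) := by
    rw [aeval_rename, Sum.elim_comp_inr]
  obtain ⟨v', hv'⟩ := X.affineCone_nonempty
  simp only [h, aeval_gen_eq_zero, mem_ideal, eval_rename, Sum.elim_comp_inr]
  exact ⟨fun h v hv => h v' hv' v hv, fun h _ _ v hv => h v hv⟩

lemma HasDim.exists_algebraicIndependent {X : ProjVariety N} {a : ℕ} (ha : X.HasDim a) :
    ∃ σ : Fin (a + 1) → HomPoly N, ∀ R : MvPolynomial (Fin (a + 1)) ℂ,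
      aeval σ R ∈ X.ideal → R = 0 := by
  obtain ⟨b, hb⟩ := exists_algebraicIndependent_of_ringKrullDim ha
  choose σ hσ using fun i => Ideal.Quotient.mk_surjective (b i)
  refine ⟨σ, fun R hR => ?_⟩
  refine (algebraicIndependent_iff.mp hb) R ?_
  have : b = fun i => Ideal.Quotient.mkₐ ℂ X.ideal (σ i) := funext fun i => (hσ i).symm
  rw [this, ← comp_aeval_apply]
  exact Ideal.Quotient.eq_zero_iff_mem.mpr hR

/-- Dimensions add. In a relation `R(σ(v), τ(v')) = 0`, fix `v'`: independence of `σ` kills every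
coefficient at `τ(v')`, and independence of `τ` then kills the coefficients themselves. -/
lemma exists_algebraicIndependent_prodField {X Z : ProjVariety N} {a b : ℕ} (ha : X.HasDim a)
    (hb : Z.HasDim b) :
    ∃ w : Fin (a + 1) ⊕ Fin (b + 1) → X.prodField Z, AlgebraicIndependent ℂ w := by
  obtain ⟨σ, hσ⟩ := ha.exists_algebraicIndependent
  obtain ⟨τ, hτ⟩ := hb.exists_algebraicIndependent
  let fam : Fin (a + 1) ⊕ Fin (b + 1) → MvPolynomial (Fin (N + 1) ⊕ Fin (N + 1)) ℂ :=
    Sum.elim (fun i => rename Sum.inl (σ i)) (fun i => rename Sum.inr (τ i))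
  refine ⟨fun i => aeval (Sum.elim (X.genFst Z) (X.genSnd Z)) (fam i), ?_⟩
  rw [algebraicIndependent_iff]
  intro R hR
  rw [← comp_aeval_apply, aeval_gen_eq_zero] at hR
  have hfam : ∀ v v' : Fin (N + 1) → ℂ, eval (Sum.elim v v') (aeval fam R) =
      eval (Sum.elim (fun i => eval v (σ i)) (fun i => eval v' (τ i))) R := by
    intro v v'
    rw [← aeval_eq_eval, comp_aeval_apply, ← aeval_eq_eval]
    congr 1
    congr 1
    funext i
    cases i <;> simp [fam, aeval_eq_eval, eval_rename]
  have hcoeff : ∀ m, coeff m (sumAlgEquiv ℂ _ _ R) = 0 := by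
    intro m
    refine hτ _ (mem_ideal.mpr fun v' hv' => ?_)
    have h1 : map (eval fun i => eval v' (τ i)) (sumAlgEquiv ℂ _ _ R) = 0 := by
      refine hσ _ (mem_ideal.mpr fun v hv => ?_)
      rw [← aeval_eq_eval, comp_aeval_apply, aeval_eq_eval]
      have := hR v hv v' hv'
      rw [hfam, eval_sumElim_eq_eval_map] at this
      simpa [aeval_eq_eval] using this
    have h2 := congrArg (coeff m) h1
    rw [coeff_map, coeff_zero] at h2
    rw [← aeval_eq_eval, comp_aeval_apply, aeval_eq_eval]
    simpa [aeval_eq_eval] using h2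
  have : sumAlgEquiv ℂ _ _ R = 0 := MvPolynomial.ext _ _ hcoeff
  exact (map_eq_zero_iff _ (sumAlgEquiv ℂ _ _).injective).mp this

end

end ProjVariety

/-! ### Jacobian determinants of a smooth complete intersection -/

noncomputable section

/-- The rows of the square matrices formed from a Jacobian matrix with `k` rows, one more row, and
`M` further rows. -/
abbrev FrameRow (k M : ℕ) : Type := (Fin k ⊕ Unit) ⊕ Fin M

/-- A bijection between the rows and the columns. -/
def frameRowEquiv (k M : ℕ) : FrameRow k M ≃ Fin (M + k + 1) :=
  Fintype.equivOfCardEq (by simp; omega)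

/-- The determinant of a family of `M + k + 1` rows. -/
def rowDet {R : Type*} [CommRing R] {k M : ℕ} (v : FrameRow k M → Fin (M + k + 1) → R) : R :=
  Matrix.det (Matrix.of fun a b => v a (frameRowEquiv k M b))

/-- The rows of the Jacobian matrix. -/
def jacRow {R : Type*} [CommRing R] [Algebra ℂ R] {k N : ℕ} (f : Fin k → HomPoly N)
    (x : Fin (N + 1) → R) (i : Fin k) (l : Fin (N + 1)) : R :=
  aeval x (pderiv l (f i))

/-- The rows of the Jacobian matrix, the row `u` and the rows `v`. -/
def frame {R : Type*} [CommRing R] [Algebra ℂ R] {k M : ℕ} (f : Fin k → HomPoly (M + k))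
    (x u : Fin (M + k + 1) → R) (v : Fin M → Fin (M + k + 1) → R) :
    FrameRow k M → Fin (M + k + 1) → R :=
  Sum.elim (Sum.elim (jacRow f x) fun _ => u) v

/-- The determinant of the Jacobian rows completed by coordinate rows. Up to sign this is a minor
of the Jacobian matrix. -/
def jacDet {R : Type*} [CommRing R] [Algebra ℂ R] {k M : ℕ} (f : Fin k → HomPoly (M + k))
    (x : Fin (M + k + 1) → R) (j : Fin (M + k + 1)) (l : Fin M → Fin (M + k + 1)) : R :=
  rowDet (frame f x (Pi.single j 1) fun r => Pi.single (l r) 1)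

lemma map_jacDet {R S : Type*} [CommRing R] [Algebra ℂ R] [CommRing S] [Algebra ℂ S]
    (φ : R →ₐ[ℂ] S) {k M : ℕ} (f : Fin k → HomPoly (M + k)) (x : Fin (M + k + 1) → R)
    (j : Fin (M + k + 1)) (l : Fin M → Fin (M + k + 1)) :
    φ (jacDet f x j l) = jacDet f (fun i => φ (x i)) j l := by
  rw [jacDet, rowDet, AlgHom.map_det, jacDet, rowDet]
  congr 1
  ext a b
  rcases a with (i | _) | r
  · simp [frame, jacRow, comp_aeval_apply]
  · simp [frame, Pi.single_apply, apply_ite φ]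
  · simp [frame, Pi.single_apply, apply_ite φ]

lemma aeval_jacDet_X {R : Type*} [CommRing R] [Algebra ℂ R] {k M : ℕ}
    (f : Fin k → HomPoly (M + k)) (x : Fin (M + k + 1) → R)
    (j : Fin (M + k + 1)) (l : Fin M → Fin (M + k + 1)) :
    aeval x (jacDet f (X : _ → HomPoly (M + k)) j l) = jacDet f x j l := by
  rw [map_jacDet]
  congr 1
  funext i
  rw [aeval_X]

lemma isHomogeneous_det {n σ : Type*} [Fintype n] [DecidableEq n]
    (A : Matrix n n (MvPolynomial σ ℂ)) (c : n → ℕ) (h : ∀ a b, (A a b).IsHomogeneous (c a)) :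
    A.det.IsHomogeneous (∑ a, c a) := by
  rw [← Matrix.det_transpose, Matrix.det_apply]
  refine IsHomogeneous.sum _ _ _ fun σ _ => ?_
  have hp : (∏ i, A.transpose (σ i) i).IsHomogeneous (∑ a, c a) :=
    IsHomogeneous.prod _ _ _ fun i _ => h i (σ i)
  rcases Int.units_eq_one_or (Equiv.Perm.sign σ) with h1 | h1
  · rw [h1, one_smul]; exact hp
  · rw [h1, Units.neg_smul, one_smul]; exact hp.neg

/-- The Jacobian rows contribute `∑ (d i - 1) = M` and the coordinate rows nothing. This is where
index one enters: against the `M + 1` powers of a coordinate in the residue formula, a degree of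
exactly one per anticanonical factor remains. -/
lemma isHomogeneous_jacDet {k M : ℕ} {d : Fin k → ℕ} {f : Fin k → HomPoly (M + k)}
    (hf : ∀ i, (f i).IsHomogeneous (d i)) (hd : ∀ i, 2 ≤ d i) (hsum : ∑ i, d i = M + k)
    (j : Fin (M + k + 1)) (l : Fin M → Fin (M + k + 1)) :
    (jacDet f (X : Fin (M + k + 1) → HomPoly (M + k)) j l).IsHomogeneous M := by
  have h := isHomogeneous_det (Matrix.of fun a b => frame f (X : _ → HomPoly (M + k))
    (Pi.single j 1) (fun r => Pi.single (l r) 1) a (frameRowEquiv k M b))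
    (Sum.elim (Sum.elim (fun i => d i - 1) fun _ => 0) fun _ => 0) ?_
  · have hM : ∑ i, (d i - 1) = M := by
      have h1 : ∑ i, (d i - 1) + ∑ _i : Fin k, 1 = ∑ i, d i := by
        rw [← Finset.sum_add_distrib]
        exact Finset.sum_congr rfl fun i _ => Nat.sub_add_cancel (by have := hd i; omega)
      simp only [Finset.sum_const, Finset.card_univ, Fintype.card_fin, smul_eq_mul, mul_one] at h1
      omega
    rw [jacDet, rowDet]
    simpa [hM] using h
  · have hsingle : ∀ i b : Fin (M + k + 1),
        ((Pi.single i 1 : Fin (M + k + 1) → HomPoly (M + k)) b).IsHomogeneous 0 := by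
      intro i b
      rw [Pi.single_apply]
      split_ifs
      · exact isHomogeneous_one _ _
      · exact isHomogeneous_zero _ _ _
    intro a b
    rcases a with (i | _) | r
    · simp only [Matrix.of_apply, frame, Sum.elim_inl, jacRow, aeval_X_left, AlgHom.id_apply]
      exact (hf i).pderiv
    · exact hsingle _ _
    · exact hsingle _ _

lemma rowDet_ne_zero_iff {K : Type*} [Field K] {k M : ℕ}
    {v : FrameRow k M → Fin (M + k + 1) → K} : rowDet v ≠ 0 ↔ LinearIndependent K v := by
  rw [rowDet, ← isUnit_iff_ne_zero, ← Matrix.isUnit_iff_isUnit_det,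
    ← Matrix.linearIndependent_rows_iff_isUnit]
  exact LinearMap.linearIndependent_iff_of_injOn
    (LinearEquiv.funCongrLeft K K (frameRowEquiv k M)).toLinearMap
    (LinearEquiv.funCongrLeft K K (frameRowEquiv k M)).injective.injOn

/-- An independent family is completed to a basis by coordinate vectors. -/
lemma exists_linearIndependent_single {K ι : Type*} [Field K] [Fintype ι] {n b : ℕ}
    {v : ι → Fin n → K} (hv : LinearIndependent K v) (hcard : Fintype.card ι + b = n) :
    ∃ l : Fin b → Fin n, LinearIndependent K (Sum.elim v fun r => Pi.single (l r) (1 : K)) := by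
  classical
  let U := Submodule.span K (Set.range v)
  obtain ⟨κ, a, -, hspan, hind⟩ := exists_linearIndependent' K
    (fun i : Fin n => U.mkQ (Pi.single i 1))
  have htop : Submodule.span K (Set.range fun i : Fin n => U.mkQ (Pi.single i (1 : K))) = ⊤ := by
    have h1 : (Set.range fun i : Fin n => U.mkQ (Pi.single i (1 : K))) =
        U.mkQ '' Set.range (Pi.basisFun K (Fin n)) := by
      rw [← Set.range_comp]
      congr 1
      funext i
      simp
    rw [h1, Submodule.span_image, (Pi.basisFun K (Fin n)).span_eq, Submodule.map_top,
      Submodule.range_mkQ]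
  have hfin : Finite κ := hind.finite
  let _ := Fintype.ofFinite κ
  have hκ : Fintype.card κ = b := by
    have h1 := finrank_span_eq_card hind
    rw [hspan, htop, finrank_top, Submodule.finrank_quotient, finrank_span_eq_card hv,
      Module.finrank_fin_fun] at h1
    omega
  let e : Fin b ≃ κ := (Fintype.equivFinOfCardEq hκ).symm
  refine ⟨a ∘ e, ?_⟩
  have hsp : LinearIndependent K fun i => (⟨v i, Submodule.subset_span ⟨i, rfl⟩⟩ : U) :=
    LinearIndependent.of_comp U.subtype hv
  exact hsp.sumElim_of_quotient _ (hind.comp e e.injective)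

lemma euler_jacRow {R : Type*} [CommRing R] [Algebra ℂ R] {k N : ℕ} {f : Fin k → HomPoly N}
    {d : Fin k → ℕ} (hf : ∀ i, (f i).IsHomogeneous (d i)) {x : Fin (N + 1) → R}
    (hx : ∀ i, aeval x (f i) = 0) (i : Fin k) : ∑ l, jacRow f x i l * x l = 0 := by
  have h := congrArg (aeval x) (hf i).sum_X_mul_pderiv
  rw [map_sum, map_nsmul, hx, smul_zero] at h
  rw [← h]
  refine Finset.sum_congr rfl fun l _ => ?_
  rw [map_mul, aeval_X, jacRow, mul_comm]

/-- Moving from the chosen representative to `z` only rescales row `i` by the `(d i - 1)`-th power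
of a unit. -/
lemma linearIndependent_jacRow {N k : ℕ} {f : Fin k → HomPoly N} {d : Fin k → ℕ}
    (hf : ∀ i, (f i).IsHomogeneous (d i)) (hsmooth : IsSmoothCI f) {z : Fin (N + 1) → ℂ}
    (hz : z ≠ 0) (hzf : ∀ i, eval z (f i) = 0) : LinearIndependent ℂ (jacRow f z) := by
  obtain ⟨a, ha⟩ := Projectivization.exists_smul_eq_mk_rep ℂ z hz
  have hmem : Projectivization.mk ℂ z hz ∈ projZeros (Set.range f) := by
    rintro _ ⟨i, rfl⟩
    rw [← ha, Units.smul_def, eval_smul_of_isHomogeneous (hf i), hzf, mul_zero]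
  have h := (hsmooth _ hmem).units_smul fun i => (a ^ (d i - 1))⁻¹
  convert h using 1
  funext i l
  rw [Pi.smul_apply', Pi.smul_apply, Units.smul_def, ← ha, Units.smul_def,
    eval_smul_of_isHomogeneous (hf i).pderiv, jacRow, aeval_eq_eval, smul_eq_mul, ← mul_assoc]
  simp

/-- By Euler's formula the Jacobian rows annihilate `z`, while the `j`-th coordinate row takes the
value `z j ≠ 0` on it. These rows are therefore independent and can be completed to a basis. -/
lemma exists_jacDet_ne_zero {M k : ℕ} {f : Fin k → HomPoly (M + k)} {d : Fin k → ℕ}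
    (hf : ∀ i, (f i).IsHomogeneous (d i)) (hsmooth : IsSmoothCI f) {z : Fin (M + k + 1) → ℂ}
    (hzf : ∀ i, eval z (f i) = 0) {j : Fin (M + k + 1)} (hj : z j ≠ 0) :
    ∃ l : Fin M → Fin (M + k + 1), jacDet f z j l ≠ 0 := by
  have hz : z ≠ 0 := fun h => hj (by rw [h]; rfl)
  have h1 := linearIndependent_jacRow hf hsmooth hz hzf
  have h2 : LinearIndependent ℂ (Sum.elim (jacRow f z)
      fun _ : Unit => (Pi.single j 1 : Fin (M + k + 1) → ℂ)) := by
    refine h1.sum_type ?_ ?_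
    · rw [linearIndependent_unique_iff]
      simp
    · rw [Set.range_const, Submodule.disjoint_span_singleton' (by simp)]
      intro hmem
      let φ : (Fin (M + k + 1) → ℂ) →ₗ[ℂ] ℂ := ∑ l, z l • LinearMap.proj l
      have hφ : Submodule.span ℂ (Set.range (jacRow f z)) ≤ LinearMap.ker φ := by
        refine Submodule.span_le.mpr ?_
        rintro _ ⟨i, rfl⟩
        have := euler_jacRow hf (x := z) (fun i => by rw [aeval_eq_eval]; exact hzf i) i
        simp only [φ, SetLike.mem_coe, LinearMap.mem_ker, LinearMap.sum_apply,
          LinearMap.smul_apply, LinearMap.proj_apply, smul_eq_mul]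
        rw [← this]
        exact Finset.sum_congr rfl fun l _ => mul_comm _ _
      have := hφ hmem
      refine hj ?_
      simpa [φ, Pi.single_apply] using this
  obtain ⟨l, hl⟩ := exists_linearIndependent_single h2 (b := M) (by simp; omega)
  exact ⟨l, rowDet_ne_zero_iff.mpr hl⟩

/-- If a coordinate vanishes at all common zeros, then a power of it lies in the ideal. -/
lemma exists_X_pow_mem_span {σ : Type*} [Finite σ] (G : Set (MvPolynomial σ ℂ)) (j : σ)
    (h : ∀ v : σ → ℂ, (∀ g ∈ G, eval v g = 0) → v j = 0) :
    ∃ r : ℕ, (X j : MvPolynomial σ ℂ) ^ r ∈ Ideal.span G := by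
  have h1 : (X j : MvPolynomial σ ℂ) ∈ (Ideal.span G).radical := by
    rw [← vanishingIdeal_zeroLocus_eq_radical (K := ℂ), mem_vanishingIdeal_iff]
    intro v hv
    rw [aeval_X]
    refine h v fun g hg => ?_
    have := (mem_zeroLocus_iff.mp hv) g (Ideal.subset_span hg)
    rwa [aeval_eq_eval] at this
  exact h1

/-- Some Jacobian determinant is nonzero at every point, over any field, of a smooth complete
intersection. -/
lemma exists_jacDet_ne_zero_of_field {E : Type*} [Field E] [Algebra ℂ E] {M k : ℕ}
    {f : Fin k → HomPoly (M + k)} {d : Fin k → ℕ}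
    (hf : ∀ i, (f i).IsHomogeneous (d i)) (hsmooth : IsSmoothCI f) {z : Fin (M + k + 1) → E}
    (hzf : ∀ i, aeval z (f i) = 0) {j : Fin (M + k + 1)} (hj : z j ≠ 0) :
    ∃ l : Fin M → Fin (M + k + 1), jacDet f z j l ≠ 0 := by
  by_contra! hcon
  -- The result over ℂ and the Nullstellensatz yield an identity expressing a power of `X j` through
  -- the equations and the determinants; it can be evaluated at a point over any field.
  obtain ⟨r, hr⟩ := exists_X_pow_mem_span (Set.range f ∪ Set.range
    fun l : Fin M → Fin (M + k + 1) => jacDet f (X : _ → HomPoly (M + k)) j l) j (by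
      intro v hv
      by_contra hvj
      obtain ⟨l, hl⟩ := exists_jacDet_ne_zero hf hsmooth (z := v)
        (fun i => hv _ (Or.inl ⟨i, rfl⟩)) hvj
      refine hl ?_
      rw [← aeval_jacDet_X, aeval_eq_eval]
      exact hv _ (Or.inr ⟨l, rfl⟩))
  have hle : Ideal.span (Set.range f ∪ Set.range
      fun l : Fin M → Fin (M + k + 1) => jacDet f (X : _ → HomPoly (M + k)) j l) ≤
      RingHom.ker (aeval z : HomPoly (M + k) →ₐ[ℂ] E) := by
    refine Ideal.span_le.mpr ?_
    rintro _ (⟨i, rfl⟩ | ⟨l, rfl⟩)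
    · exact hzf i
    · exact (aeval_jacDet_X f z j l).trans (hcon l)
  have := hle hr
  rw [RingHom.mem_ker, map_pow, aeval_X] at this
  exact hj (eq_zero_of_pow_eq_zero this)

/-- A vector in the kernel of the Jacobian matrix is determined by `M + 1` of its coordinates. -/
lemma mem_of_jacDet_ne_zero {E : Type*} [Field E] [Algebra ℂ E] {M k : ℕ}
    {f : Fin k → HomPoly (M + k)} {z p : Fin (M + k + 1) → E} {j : Fin (M + k + 1)}
    {l : Fin M → Fin (M + k + 1)} (hdet : jacDet f z j l ≠ 0)
    (hp : ∀ i, ∑ c, jacRow f z i c * p c = 0) (L : Subfield E)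
    (hL : ∀ i c, jacRow f z i c ∈ L) (hj : p j ∈ L) (hl : ∀ r, p (l r) ∈ L)
    (c : Fin (M + k + 1)) : p c ∈ L := by
  let v := frame f z (Pi.single j 1) fun r => Pi.single (l r) 1
  have hv : ∀ a b, v a b ∈ L := by
    have hsingle : ∀ i b : Fin (M + k + 1), (Pi.single i 1 : Fin (M + k + 1) → E) b ∈ L := by
      intro i b
      rw [Pi.single_apply]
      split_ifs
      · exact one_mem _
      · exact zero_mem _
    intro a b
    rcases a with (i | _) | r
    · exact hL i b
    · exact hsingle _ _
    · exact hsingle _ _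
  -- The vector `p` solves a square linear system whose matrix and right-hand side have entries in
  -- `L`; inverting over `L` puts the solution there.
  let A₀ : Matrix (FrameRow k M) (FrameRow k M) L :=
    Matrix.of fun a b => ⟨v a (frameRowEquiv k M b), hv _ _⟩
  have hA : L.subtype.mapMatrix A₀ = Matrix.of fun a b => v a (frameRowEquiv k M b) := rfl
  have hdet₀ : IsUnit A₀.det := by
    rw [isUnit_iff_ne_zero]
    intro h0
    apply hdet
    rw [jacDet, rowDet, ← show L.subtype.mapMatrix A₀ = _ from hA, ← RingHom.map_det, h0, map_zero]
  let b₀ : FrameRow k M → L := Sum.elim (Sum.elim (fun _ => 0) fun _ => ⟨p j, hj⟩)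
    fun r => ⟨p (l r), hl r⟩
  have hAp : (L.subtype.mapMatrix A₀).mulVec (p ∘ frameRowEquiv k M) = L.subtype ∘ b₀ := by
    funext a
    have h1 : (L.subtype.mapMatrix A₀).mulVec (p ∘ frameRowEquiv k M) a = ∑ c, v a c * p c := by
      rw [hA]
      exact (frameRowEquiv k M).sum_comp fun c => v a c * p c
    rw [h1]
    rcases a with (i | _) | r
    · simpa [v, frame, b₀] using hp i
    · simp [v, frame, b₀, Pi.single_apply]
    · simp [v, frame, b₀, Pi.single_apply]
  have hsol : p ∘ frameRowEquiv k M = L.subtype ∘ (A₀⁻¹.mulVec b₀) := by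
    have h1 : (L.subtype.mapMatrix A₀⁻¹) * (L.subtype.mapMatrix A₀) = 1 := by
      rw [← map_mul, Matrix.nonsing_inv_mul _ hdet₀, map_one]
    calc p ∘ frameRowEquiv k M
        = (L.subtype.mapMatrix A₀⁻¹).mulVec
            ((L.subtype.mapMatrix A₀).mulVec (p ∘ frameRowEquiv k M)) := by
          rw [Matrix.mulVec_mulVec, h1, Matrix.one_mulVec]
      _ = (L.subtype.mapMatrix A₀⁻¹).mulVec (L.subtype ∘ b₀) := by rw [hAp]
      _ = L.subtype ∘ (A₀⁻¹.mulVec b₀) := by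
          funext a
          rw [Function.comp_apply, RingHom.map_mulVec]
          rfl
  have := congrFun hsol ((frameRowEquiv k M).symm c)
  rw [Function.comp_apply, Equiv.apply_symm_apply] at this
  rw [this]
  exact (A₀⁻¹.mulVec b₀ _).2

end

/-! ### Common zeros of forms on a projective variety -/

namespace ProjVariety

variable {N : ℕ}

lemma mem_affineCone_of_forall (Y : ProjVariety N) {v : Fin (N + 1) → ℂ} (hv : v ≠ 0)
    (h : ∀ q ∈ Y.ideal, ∀ e : ℕ, q.IsHomogeneous e → eval v q = 0) :
    v ∈ affineCone Y.carrier := by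
  obtain ⟨T, hT, hY⟩ := Y.isAlgebraicSet
  refine ⟨hv, ?_⟩
  rw [hY]
  intro g hg
  obtain ⟨m, hm⟩ := hT g hg
  have hgY : g ∈ Y.ideal := by
    rw [mem_ideal]
    rintro w ⟨hw, hwY⟩
    rw [hY] at hwY
    exact eval_eq_zero_of_rep hm hw (hwY g hg)
  obtain ⟨a, ha⟩ := Projectivization.exists_smul_eq_mk_rep ℂ v hv
  rw [← ha, Units.smul_def, eval_smul_of_isHomogeneous hm, h g hgY m hm, mul_zero]

/-- A set of homogeneous generators of an ideal containing the ideal of the variety `Y` and having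
no common zero on `Y` generates an ideal containing a power of each coordinate. -/
lemma exists_forall_X_pow_mem_span (Y : ProjVariety N) (G : Set (HomPoly N))
    (hG : ∀ v ∈ affineCone Y.carrier, ∃ g ∈ G, eval v g ≠ 0) :
    ∃ r : ℕ, ∀ j : Fin (N + 1), (X j : HomPoly N) ^ r ∈
      Ideal.span ({q | q ∈ Y.ideal ∧ ∃ e : ℕ, q.IsHomogeneous e} ∪ G) := by
  choose r hr using fun j : Fin (N + 1) => exists_X_pow_mem_span
    ({q | q ∈ Y.ideal ∧ ∃ e : ℕ, q.IsHomogeneous e} ∪ G) j (fun v hv => by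
      by_contra hvj
      have hv0 : v ≠ 0 := fun h => hvj (by rw [h]; rfl)
      obtain ⟨g, hg, hne⟩ := hG v (Y.mem_affineCone_of_forall hv0
        fun q hq e he => hv q (Or.inl ⟨hq, e, he⟩))
      exact hne (hv g (Or.inr hg)))
  exact ⟨∑ j, r j, fun j => Ideal.pow_mem_of_pow_mem _ (hr j)
    (Finset.single_le_sum (fun _ _ => Nat.zero_le _) (Finset.mem_univ j))⟩

/-- On a projective variety of dimension `k`, any `k` forms of positive degree have a common
zero. -/
lemma HasDim.exists_common_zero {Y : ProjVariety N} {k : ℕ} (hY : Y.HasDim k)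
    (L : Fin k → HomPoly N) (c : Fin k → ℕ) (hc : ∀ i, 0 < c i)
    (hL : ∀ i, (L i).IsHomogeneous (c i)) :
    ∃ v ∈ affineCone Y.carrier, ∀ i, eval v (L i) = 0 := by
  classical
  -- Without a common zero the coordinate ring of `Y` would be finite over the subalgebra generated
  -- by the `k` forms, hence of transcendence degree at most `k`, not `k + 1`.
  by_contra! hcon
  obtain ⟨r, hr⟩ := Y.exists_forall_X_pow_mem_span (Set.range L) (fun v hv => by
    obtain ⟨i, hi⟩ := hcon v hv
    exact ⟨L i, ⟨i, rfl⟩, hi⟩)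
  let B := Y.coordRing
  let φ : HomPoly N →ₐ[ℂ] B := Ideal.Quotient.mkₐ ℂ Y.ideal
  let S₀ : Subalgebra ℂ B := Algebra.adjoin ℂ (Set.range fun i => φ (L i))
  -- Above this degree a monomial contains some `X j ^ r`, so modulo the ideal of `Y` it is a
  -- combination of the `L i` with coefficients of strictly smaller degree.
  let D := Fintype.card (Fin (N + 1)) * r
  let W : Submodule S₀ B := Submodule.span S₀
    ((fun m => φ (monomial m 1)) '' {m : Fin (N + 1) →₀ ℕ | m.degree ≤ D})
  have hmon : ∀ e : ℕ, ∀ m : Fin (N + 1) →₀ ℕ, m.degree = e → φ (monomial m 1) ∈ W := by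
    intro e
    induction e using Nat.strong_induction_on with
    | _ e ih =>
    intro m hm
    by_cases hme : e ≤ D
    · exact Submodule.subset_span ⟨m, hm.trans_le hme, rfl⟩
    obtain ⟨j, hj⟩ := exists_le_apply_of_lt_degree (m := m) (r := r) (by rw [hm]; omega)
    have hmem : monomial m (1 : ℂ) ∈
        Ideal.span ({q | q ∈ Y.ideal ∧ ∃ e : ℕ, q.IsHomogeneous e} ∪ Set.range L) := by
      have h1 : monomial m (1 : ℂ) = monomial (m - Finsupp.single j r) 1 * X j ^ r := by
        rw [X_pow_eq_monomial, monomial_mul, mul_one, tsub_add_cancel_of_le]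
        rwa [Finsupp.single_le_iff]
      rw [h1]
      exact Ideal.mul_mem_left _ _ (hr j)
    have hforms : ∀ e' < e, ∀ q : HomPoly N, q.IsHomogeneous e' → φ q ∈ W := by
      intro e' he' q hq
      rw [q.as_sum, map_sum]
      refine sum_mem fun m' hm' => ?_
      have h1 : monomial m' (coeff m' q) = coeff m' q • monomial m' 1 := by
        rw [smul_monomial, smul_eq_mul, mul_one]
      rw [h1, map_smul, ← algebraMap_smul S₀ (coeff m' q) (φ _)]
      exact Submodule.smul_mem _ _ (ih e' he' m' (hq.degree_eq hm'))
    -- Only the component of degree `e` is constrained; other degrees get the trivial condition,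
    -- since the induction hypothesis covers coefficients of degree below `e` only.
    let W' : ℕ → AddSubgroup B := fun e' => if e' = e then W.toAddSubgroup else ⊤
    have key := map_homogeneousComponent_mem_of_mem_span (φ : HomPoly N →+ B) W' _ (by
      rintro g (⟨hg, e', he'⟩ | ⟨i, rfl⟩)
      · refine ⟨e', he', fun d₁ q _ => ?_⟩
        have : φ (q * g) = 0 := Ideal.Quotient.eq_zero_iff_mem.mpr (Ideal.mul_mem_left _ _ hg)
        exact this ▸ zero_mem _
      · refine ⟨c i, hL i, fun d₁ q hq => ?_⟩
        simp only [W']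
        split_ifs with h
        · have h2 := hforms d₁ (by have := hc i; omega) q hq
          have h3 : φ (q * L i) =
              (⟨φ (L i), Algebra.subset_adjoin ⟨i, rfl⟩⟩ : S₀) • φ q := by
            rw [map_mul, mul_comm]; rfl
          exact h3 ▸ Submodule.smul_mem _ _ h2
        · trivial) hmem e
    rw [homogeneousComponent_of_mem (isHomogeneous_monomial 1 hm), if_pos rfl] at key
    simpa [W'] using key
  have htop : W = ⊤ := by
    rw [eq_top_iff]
    rintro b -
    obtain ⟨q, rfl⟩ := Ideal.Quotient.mk_surjective b
    change φ q ∈ W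
    rw [q.as_sum, map_sum]
    refine sum_mem fun m' _ => ?_
    have h1 : monomial m' (coeff m' q) = coeff m' q • monomial m' 1 := by
      rw [smul_monomial, smul_eq_mul, mul_one]
    rw [h1, map_smul, ← algebraMap_smul S₀ (coeff m' q) (φ _)]
    exact Submodule.smul_mem _ _ (hmon _ m' rfl)
  have hfin : Module.Finite S₀ B := ⟨by
    rw [← htop]
    exact Submodule.fg_span ((Finsupp.finite_of_degree_le D).image _)⟩
  have hint : Algebra.IsIntegral S₀ B := Algebra.IsIntegral.of_finite S₀ B
  have halg : Algebra.IsAlgebraic (Algebra.adjoin ℂ (Set.range fun i => φ (L i))) B :=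
    hint.isAlgebraic
  have h1 := Algebra.IsAlgebraic.trdeg_le_cardinalMk ℂ (A := B) (Set.range fun i => φ (L i))
  rw [trdeg_eq_of_ringKrullDim_eq ℂ hY] at h1
  have h2 := h1.trans Cardinal.mk_range_le
  rw [Cardinal.mk_fin] at h2
  have : k + 1 ≤ k := by exact_mod_cast h2
  omega

end ProjVariety

/-! ### Density of the differences of points of two cones -/

lemma hasStrictFDerivAt_eval {n : ℕ} (q : MvPolynomial (Fin n) ℂ) (v : Fin n → ℂ) :
    HasStrictFDerivAt (fun w : Fin n → ℂ => eval w q)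
      (∑ l, eval v (pderiv l q) • (ContinuousLinearMap.proj l : (Fin n → ℂ) →L[ℂ] ℂ)) v := by
  induction q using MvPolynomial.induction_on with
  | C a =>
    simp only [eval_C]
    exact (hasStrictFDerivAt_const a v).congr_fderiv (by ext; simp)
  | add p q hp hq =>
    simp only [map_add]
    refine (hp.fun_add hq).congr_fderiv (ContinuousLinearMap.ext fun w => ?_)
    simp [add_mul, Finset.sum_add_distrib]
  | mul_X p i hp =>
    have hX : HasStrictFDerivAt (fun w : Fin n → ℂ => w i)
        (ContinuousLinearMap.proj i : (Fin n → ℂ) →L[ℂ] ℂ) v :=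
      (ContinuousLinearMap.proj (R := ℂ) (φ := fun _ : Fin n => ℂ) i).hasStrictFDerivAt
    simp only [map_mul, eval_X]
    refine (hp.fun_mul hX).congr_fderiv (ContinuousLinearMap.ext fun w => ?_)
    simp [pderiv_X, Pi.single_apply, apply_ite (eval v), add_mul, Finset.sum_add_distrib,
      Finset.mul_sum, mul_assoc]

/-- A polynomial vanishing on all differences of points of the cone over a smooth complete
intersection and of the cone over a subvariety vanishes on the tangent spaces. -/
lemma eval_eq_zero_of_mem_tangentSpace {N k : ℕ} {f : Fin k → HomPoly N} {d : Fin k → ℕ}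
    (hf : ∀ i, (f i).IsHomogeneous (d i)) (hsmooth : IsSmoothCI f) {F Y : ProjVariety N}
    (hF : F.carrier = projZeros (Set.range f)) (hYF : Y.carrier ⊆ F.carrier) {a : HomPoly N}
    (ha : ∀ v ∈ affineCone F.carrier, ∀ w ∈ affineCone Y.carrier, eval (v - w) a = 0)
    {y p : Fin (N + 1) → ℂ} (hy : y ∈ affineCone Y.carrier)
    (hp : ∀ i, ∑ l, jacRow f y i l * p l = 0) : eval p a = 0 := by
  have hfF : ∀ v : Fin (N + 1) → ℂ, v ≠ 0 → (v ∈ affineCone F.carrier ↔ ∀ i, eval v (f i) = 0) := by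
    intro v hv
    constructor
    · rintro ⟨hv', hvF⟩ i
      rw [hF] at hvF
      exact eval_eq_zero_of_rep (hf i) hv' (hvF _ ⟨i, rfl⟩)
    · intro h
      refine ⟨hv, ?_⟩
      rw [hF]
      rintro _ ⟨i, rfl⟩
      obtain ⟨b, hb⟩ := Projectivization.exists_smul_eq_mk_rep ℂ v hv
      rw [← hb, Units.smul_def, eval_smul_of_isHomogeneous (hf i), h i, mul_zero]
  have hy0 : y ≠ 0 := hy.1
  have hyF : ∀ i, eval y (f i) = 0 := (hfF y hy0).mp ⟨hy.1, hYF hy.2⟩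
  let g : (Fin (N + 1) → ℂ) → Fin k → ℂ := fun w i => eval w (f i)
  let g' : (Fin (N + 1) → ℂ) →L[ℂ] Fin k → ℂ := ContinuousLinearMap.pi fun i =>
    ∑ l, eval y (pderiv l (f i)) • (ContinuousLinearMap.proj l : (Fin (N + 1) → ℂ) →L[ℂ] ℂ)
  have hg : HasStrictFDerivAt g g' y :=
    hasStrictFDerivAt_pi.mpr fun i => hasStrictFDerivAt_eval (f i) y
  have hg'apply : ∀ w i, g' w i = ∑ l, jacRow f y i l * w l := by
    intro w i
    simp [g', jacRow, aeval_eq_eval]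
  have hrange : (g' : (Fin (N + 1) → ℂ) →ₗ[ℂ] Fin k → ℂ).range = ⊤ := by
    have hind := linearIndependent_jacRow hf hsmooth hy0 hyF
    have hmat : (g' : (Fin (N + 1) → ℂ) →ₗ[ℂ] Fin k → ℂ) =
        (Matrix.of (jacRow f y)).mulVecLin := by
      ext w i
      simp [hg'apply, Matrix.mulVec, dotProduct]
    rw [hmat]
    have h1 : (Matrix.of (jacRow f y)).rank = k := by
      have := LinearIndependent.rank_matrix (M := Matrix.of (jacRow f y)) hind
      simpa using this
    refine Submodule.eq_top_of_finrank_eq ?_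
    rw [Module.finrank_fin_fun]
    exact h1
  have hpker : p ∈ (g' : (Fin (N + 1) → ℂ) →ₗ[ℂ] Fin k → ℂ).ker := by
    rw [LinearMap.mem_ker]
    funext i
    exact (hg'apply p i).trans (hp i)
  -- Smoothness gives a curve through `y` in the cone over `F` with velocity `p`; the difference
  -- quotients `(curve t - y) / t` tend to `p`.
  let φ := HasStrictFDerivAt.implicitFunction g g' hg hrange (g y)
  have hφ0 : φ 0 = y := hg.implicitFunction_apply_image hrange
  let curve : ℂ → Fin (N + 1) → ℂ := fun t => φ (t • ⟨p, hpker⟩)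
  have hlin : HasDerivAt (fun t : ℂ => t • (⟨p, hpker⟩ :
      (g' : (Fin (N + 1) → ℂ) →ₗ[ℂ] Fin k → ℂ).ker)) ⟨p, hpker⟩ 0 := by
    simpa using (hasDerivAt_id (0 : ℂ)).smul_const (⟨p, hpker⟩ :
      (g' : (Fin (N + 1) → ℂ) →ₗ[ℂ] Fin k → ℂ).ker)
  have hcurve : HasDerivAt curve p 0 := by
    have h1 : HasFDerivAt φ ((g' : (Fin (N + 1) → ℂ) →ₗ[ℂ] Fin k → ℂ).ker.subtypeL)
        ((0 : ℂ) • ⟨p, hpker⟩) := by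
      rw [zero_smul]
      exact (hg.to_implicitFunction hrange).hasFDerivAt
    exact h1.comp_hasDerivAt (0 : ℂ) hlin
  have hcurve0 : curve 0 = y := by simp only [curve, zero_smul, hφ0]
  have hslope := hasDerivAt_iff_tendsto_slope_zero.mp hcurve
  simp only [zero_add, hcurve0] at hslope
  have hmemF : ∀ᶠ t in nhds (0 : ℂ), curve t ∈ affineCone F.carrier := by
    have h1 : ∀ᶠ t in nhds (0 : ℂ), curve t ≠ 0 :=
      hcurve.continuousAt.eventually_ne (by rw [hcurve0]; exact hy0)
    have h2 : Filter.Tendsto (fun t : ℂ => (g y, t • (⟨p, hpker⟩ :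
        (g' : (Fin (N + 1) → ℂ) →ₗ[ℂ] Fin k → ℂ).ker))) (nhds 0) (nhds (g y, 0)) := by
      have := hlin.continuousAt.tendsto
      rw [zero_smul] at this
      exact tendsto_const_nhds.prodMk_nhds this
    have h3 := h2.eventually (hg.map_implicitFunction_eq hrange)
    filter_upwards [h1, h3] with t ht1 ht3
    refine (hfF _ ht1).mpr fun i => ?_
    have := congrFun ht3 i
    exact this.trans (hyF i)
  have hlim : Filter.Tendsto (fun t : ℂ => eval (t⁻¹ • (curve t - y)) a) (nhdsWithin 0 {0}ᶜ)
      (nhds (eval p a)) := ((continuous_eval a).tendsto p).comp hslope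
  refine tendsto_nhds_unique_of_eventuallyEq hlim tendsto_const_nhds ?_
  have h1 : ∀ᶠ t in nhdsWithin (0 : ℂ) {0}ᶜ, curve t ∈ affineCone F.carrier :=
    hmemF.filter_mono nhdsWithin_le_nhds
  filter_upwards [h1, self_mem_nhdsWithin] with t ht ht0
  rw [smul_sub]
  -- Cones are stable under scaling by `t⁻¹`, so the difference quotient is itself a difference of
  -- points of the two cones, where `a` vanishes.
  exact ha _ (smul_mem_affineCone ht (inv_ne_zero ht0)) _
    (smul_mem_affineCone hy (inv_ne_zero ht0))

/-- The differences of the points of the cones over `F` and `Y` are Zariski dense. -/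
lemma eq_zero_of_forall_eval_sub_eq_zero {N k : ℕ} {f : Fin k → HomPoly N} {d : Fin k → ℕ}
    (hd : ∀ i, 2 ≤ d i) (hf : ∀ i, (f i).IsHomogeneous (d i)) (hsmooth : IsSmoothCI f)
    {F Y : ProjVariety N} (hF : F.carrier = projZeros (Set.range f)) (hYF : Y.carrier ⊆ F.carrier)
    (hY : Y.HasDim k) {a : HomPoly N}
    (ha : ∀ v ∈ affineCone F.carrier, ∀ w ∈ affineCone Y.carrier, eval (v - w) a = 0) : a = 0 := by
  refine MvPolynomial.funext fun p => ?_
  rw [map_zero]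
  -- The derivatives of the `f i` in direction `p` are `k` forms of positive degrees `d i - 1` on
  -- the `k`-dimensional `Y`. At a common zero `y`, the vector `p` is tangent to the cone over `F`.
  obtain ⟨y, hy, hyp⟩ := hY.exists_common_zero
    (fun i => ∑ l, pderiv l (f i) * (C (p l) : HomPoly N)) (fun i => d i - 1)
    (fun i => by have := hd i; omega)
    (fun i => IsHomogeneous.sum _ _ _ fun l _ => by
      simpa using (hf i).pderiv.mul (isHomogeneous_C (Fin (N + 1)) (p l)))
  refine eval_eq_zero_of_mem_tangentSpace hf hsmooth hF hYF ha hy (p := p) fun i => ?_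
  have := hyp i
  simp only [map_sum, map_mul, eval_C] at this
  simpa [jacRow, aeval_eq_eval] using this

/-- The difference map is dominant: a relation between the coordinates of the generic difference
would vanish at all differences of points. -/
lemma ProjVariety.algebraicIndependent_genFst_sub_genSnd {N k : ℕ} {f : Fin k → HomPoly N}
    {d : Fin k → ℕ} (hd : ∀ i, 2 ≤ d i) (hf : ∀ i, (f i).IsHomogeneous (d i))
    (hsmooth : IsSmoothCI f) {F Y : ProjVariety N} (hF : F.carrier = projZeros (Set.range f))
    (hYF : Y.carrier ⊆ F.carrier) (hY : Y.HasDim k) :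
    AlgebraicIndependent ℂ fun i => F.genFst Y i - F.genSnd Y i := by
  rw [algebraicIndependent_iff]
  intro a ha
  have h1 : (fun i => F.genFst Y i - F.genSnd Y i) = fun i =>
      aeval (Sum.elim (F.genFst Y) (F.genSnd Y))
        (X (Sum.inl i) - X (Sum.inr i) : MvPolynomial (Fin (N + 1) ⊕ Fin (N + 1)) ℂ) := by
    funext i
    simp
  rw [h1, ← comp_aeval_apply, aeval_gen_eq_zero] at ha
  refine eq_zero_of_forall_eval_sub_eq_zero hd hf hsmooth hF hYF hY fun v hv w hw => ?_
  rw [← ha v hv w hw, ← aeval_eq_eval (Sum.elim v w), comp_aeval_apply, aeval_eq_eval]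
  congr 2
  funext i
  simp

/-! ### Transcendence degree as rank in the algebraic matroid -/

section AlgebraicRank

variable {E : Type} [Field E] [Algebra ℂ E]

/-- The subfield of the elements algebraic over `ℂ(S)`. -/
def algClosureSubfield (S : Set E) : Subfield E where
  carrier := {x | IsAlgebraic (Algebra.adjoin ℂ S) x}
  mul_mem' := fun ha hb => ha.mul hb
  one_mem' := isAlgebraic_one
  add_mem' := fun ha hb => ha.add hb
  zero_mem' := isAlgebraic_zero
  neg_mem' := fun ha => ha.neg
  inv_mem' := fun _ ha => ha.inv

lemma mem_algClosureSubfield_iff {S : Set E} {x : E} :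
    x ∈ algClosureSubfield S ↔ x ∈ (AlgebraicIndependent.matroid ℂ E).closure S := by
  rw [AlgebraicIndependent.matroid_closure_eq, SetLike.mem_coe, Subalgebra.mem_algebraicClosure]
  rfl

lemma subset_algClosureSubfield {S : Set E} {x : E} (hx : x ∈ S) : x ∈ algClosureSubfield S := by
  rw [mem_algClosureSubfield_iff]
  exact Matroid.subset_closure _ _ (by simp) hx

lemma algebraMap_mem_algClosureSubfield (S : Set E) (c : ℂ) :
    algebraMap ℂ E c ∈ algClosureSubfield S :=
  isAlgebraic_algebraMap (A := E) (algebraMap ℂ (Algebra.adjoin ℂ S) c)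

lemma aeval_mem_algClosureSubfield {S : Set E} {ι : Type*} {x : ι → E}
    (hx : ∀ i, x i ∈ algClosureSubfield S) (q : MvPolynomial ι ℂ) :
    aeval x q ∈ algClosureSubfield S := by
  induction q using MvPolynomial.induction_on with
  | C a => rw [← algebraMap_eq, AlgHom.commutes]; exact algebraMap_mem_algClosureSubfield S a
  | add p q hp hq => rw [map_add]; exact add_mem hp hq
  | mul_X p i hp => rw [map_mul, aeval_X]; exact mul_mem hp (hx i)

lemma card_le_eRk {ι : Type} [Fintype ι] {w : ι → E} (hw : AlgebraicIndependent ℂ w) {S : Set E}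
    (h : ∀ i, w i ∈ algClosureSubfield S) :
    (Fintype.card ι : ℕ∞) ≤ (AlgebraicIndependent.matroid ℂ E).eRk S := by
  rw [← Matroid.eRk_closure_eq]
  have hind : (AlgebraicIndependent.matroid ℂ E).Indep (Set.range w) :=
    AlgebraicIndependent.matroid_indep_iff.mpr hw.to_subtype_range
  have h1 := hind.encard_le_eRk_of_subset (X := (AlgebraicIndependent.matroid ℂ E).closure S) (by
    rintro _ ⟨i, rfl⟩
    exact mem_algClosureSubfield_iff.mp (h i))
  rwa [← Set.image_univ, hw.injective.encard_image, Set.encard_univ, ENat.card_eq_coe_fintype_card]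
    at h1

/-- A basis of the image lifts to elements of `A`, and lifts of independent elements are
independent. -/
lemma eRk_range_le_of_trdeg_le {A : Type} [CommRing A] [Algebra ℂ A] (φ : A →ₐ[ℂ] E) {k : ℕ}
    (h : Algebra.trdeg ℂ A ≤ k) :
    (AlgebraicIndependent.matroid ℂ E).eRk (Set.range φ) ≤ k := by
  obtain ⟨T, hT⟩ := (AlgebraicIndependent.matroid ℂ E).exists_isBasis (Set.range φ)
  rw [← hT.encard_eq_eRk]
  have hind : AlgebraicIndependent ℂ ((↑) : T → E) :=
    AlgebraicIndependent.matroid_indep_iff.mp hT.indep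
  choose g hg using fun t : T => hT.subset t.2
  have hg' : AlgebraicIndependent ℂ g := by
    refine AlgebraicIndependent.of_comp φ ?_
    have : φ ∘ g = ((↑) : T → E) := funext hg
    rwa [this]
  have h1 := hg'.cardinalMk_le_trdeg.trans h
  have h2 : Cardinal.toENat (Cardinal.mk T) ≤ Cardinal.toENat (k : Cardinal) :=
    Cardinal.toENat.monotone' h1
  rw [map_natCast] at h2
  exact h2

open scoped IntermediateField.algebraAdjoinAdjoin in
lemma mem_algClosureSubfield_of_isAlgebraic_adjoin {S : Set E} {z : E}
    (h : IsAlgebraic (IntermediateField.adjoin ℂ S) z) : z ∈ algClosureSubfield S :=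
  (IsFractionRing.isAlgebraic_iff (Algebra.adjoin ℂ S) (IntermediateField.adjoin ℂ S) E).mpr h

end AlgebraicRank

lemma aeval_mul_left_of_isHomogeneous {σ R : Type*} [CommRing R] [Algebra ℂ R]
    {q : MvPolynomial σ ℂ} {e : ℕ} (hq : q.IsHomogeneous e) (t : R) (x : σ → R) :
    aeval (fun i => t * x i) q = t ^ e * aeval x q := by
  rw [q.as_sum, map_sum, map_sum, Finset.mul_sum]
  refine Finset.sum_congr rfl fun m hm => ?_
  rw [aeval_monomial, aeval_monomial]
  have h1 : (m.prod fun i a => (t * x i) ^ a) = t ^ e * m.prod fun i a => x i ^ a := by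
    simp only [mul_pow, Finsupp.prod_mul]
    congr 1
    rw [← hq.degree_eq hm, Finsupp.prod, Finset.prod_pow_eq_pow_sum]
    rfl
  rw [h1]
  ring

/-! ### Polar equations in a generic direction -/

noncomputable section

/-- The polynomial ring in the coordinates of a point of the cone, with coefficients in the ring of
polynomials in the coordinates of a direction. -/
abbrev PolarRing (N : ℕ) : Type := MvPolynomial (Fin (N + 1)) (HomPoly N)

/-- The derivative of `f` in the indeterminate direction. -/
def polarForm {N : ℕ} (f : HomPoly N) : PolarRing N :=
  ∑ l, map C (pderiv l f) * C (X l)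

/-- The equations of the points of `Y` where `Q` and the derivatives of the `f i` in the
indeterminate direction vanish. -/
def polarEquations {N k : ℕ} (f : Fin k → HomPoly N) (Y : ProjVariety N) (Q : HomPoly N) :
    Set (PolarRing N) :=
  map C '' {q | q ∈ Y.ideal ∧ ∃ e : ℕ, q.IsHomogeneous e} ∪
    insert (map C Q) (Set.range fun i => polarForm (f i))

lemma aeval_eq_zero_of_mem_ideal {N : ℕ} {E : Type*} [CommRing E] [Algebra ℂ E]
    {Y : ProjVariety N} {y : Fin (N + 1) → E}
    (h : ∀ q ∈ Y.ideal, ∀ e : ℕ, q.IsHomogeneous e → aeval y q = 0) {q : HomPoly N}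
    (hq : q ∈ Y.ideal) : aeval y q = 0 := by
  rw [← sum_homogeneousComponent q, map_sum]
  exact Finset.sum_eq_zero fun e _ => h _ (Y.homogeneousComponent_mem hq e) e
    (homogeneousComponent_isHomogeneous e q)

/-- Over a field, there is no point of the set defined by the polar equations whose direction is
generic and whose multiples by an indeterminate exist. -/
lemma not_algebraicIndependent_of_polar {M k : ℕ} {f : Fin k → HomPoly (M + k)} {d : Fin k → ℕ}
    (hf : ∀ i, (f i).IsHomogeneous (d i)) (hsmooth : IsSmoothCI f) {Y : ProjVariety (M + k)}
    (hfY : ∀ i, f i ∈ Y.ideal) (hY : Y.HasDim k) {Q : HomPoly (M + k)} (hQ : Q ∉ Y.ideal)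
    {E : Type} [Field E] [Algebra ℂ E] {y p : Fin (M + k + 1) → E} {j : Fin (M + k + 1)}
    (hyj : y j ≠ 0) (hy : ∀ q ∈ Y.ideal, aeval y q = 0) (hyQ : aeval y Q = 0)
    (hyp : ∀ i, ∑ l, jacRow f y i l * p l = 0) :
    ¬ AlgebraicIndependent ℂ (fun o : Option (Fin (M + k + 1)) => o.elim (y j) p) := by
  intro hind
  let φ : HomPoly (M + k) →ₐ[ℂ] E := aeval y
  -- As `Q` vanishes at `y` but not on `Y`, the point lies on a proper closed subset of the cone
  -- over `Y`, so its coordinates have rank at most `k`.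
  have hker : Y.ideal < RingHom.ker φ := by
    refine lt_of_le_of_ne (fun q hq => hy q hq) fun h => hQ ?_
    rw [h]
    exact hyQ
  have hrk : (AlgebraicIndependent.matroid ℂ E).eRk (Set.range φ) ≤ k := by
    have : (RingHom.ker φ).IsPrime := RingHom.ker_isPrime _
    have h1 := trdeg_quotient_le_of_lt ℂ hker hY
    have h2 := eRk_range_le_of_trdeg_le (Ideal.kerLiftAlg φ) h1
    refine le_trans (Matroid.eRk_mono _ ?_) h2
    rintro _ ⟨q, rfl⟩
    exact ⟨Ideal.Quotient.mk _ q, Ideal.kerLiftAlg_mk φ q⟩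
  obtain ⟨l, hl⟩ := exists_jacDet_ne_zero_of_field hf hsmooth
    (fun i => hy _ (hfY i)) hyj
  -- Over the field generated by `y`, the tangent vector `p` is determined by `M + 1` of its
  -- coordinates. The rank is thus at most `k + M + 1`, one less than the number of elements `y j,
  -- p`.
  let S : Set E := Set.range φ ∪ insert (p j) (Set.range fun r => p (l r))
  have hφS : ∀ q, φ q ∈ algClosureSubfield S := fun q =>
    subset_algClosureSubfield (Or.inl ⟨q, rfl⟩)
  have hp : ∀ c, p c ∈ algClosureSubfield S := mem_of_jacDet_ne_zero hl hyp _
    (fun i c => hφS _) (subset_algClosureSubfield (Or.inr (Or.inl rfl)))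
    fun r => subset_algClosureSubfield (Or.inr (Or.inr ⟨r, rfl⟩))
  have h1 := card_le_eRk hind (S := S) (by
    rintro (_ | c)
    · have := hφS (X j)
      simpa [φ] using this
    · exact hp c)
  have h2 : (AlgebraicIndependent.matroid ℂ E).eRk S ≤ k + (M + 1) := by
    refine (Matroid.eRk_union_le_eRk_add_encard _ _ _).trans (add_le_add hrk ?_)
    refine (Set.encard_insert_le _ _).trans (add_le_add ?_ le_rfl)
    rw [← Set.image_univ]
    refine (Set.encard_image_le _ _).trans ?_
    simp
  have h3 := h1.trans h2
  simp only [Fintype.card_option, Fintype.card_fin] at h3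
  have h4 : M + k + 1 + 1 ≤ k + (M + 1) := by exact_mod_cast h3
  omega

/-- The equations are homogeneous in the point, so it may be multiplied by a quantity `u`
transcendental over the field of the given solution. This makes `y j` independent of the generic
direction `p`, producing the extra independent element needed in
`not_algebraicIndependent_of_polar`. -/
lemma false_of_polarEquations {M k : ℕ} {f : Fin k → HomPoly (M + k)}
    {d : Fin k → ℕ} (hf : ∀ i, (f i).IsHomogeneous (d i)) (hsmooth : IsSmoothCI f)
    {Y : ProjVariety (M + k)} (hfY : ∀ i, f i ∈ Y.ideal) (hY : Y.HasDim k) {Q : HomPoly (M + k)}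
    {δ : ℕ} (hQδ : Q.IsHomogeneous δ) (hQ : Q ∉ Y.ideal) {j : Fin (M + k + 1)}
    {E₀ E : Type} [Field E₀] [Algebra ℂ E₀] [Field E] [Algebra ℂ E] [Algebra E₀ E]
    [IsScalarTower ℂ E₀ E] (π : PolarRing (M + k) →ₐ[ℂ] E₀)
    (hle : ∀ z ∈ polarEquations f Y Q, π z = 0)
    (hC : ∀ a, π (C a) = 0 → a = 0) (hj : π (X j) ≠ 0) {u : E} (hu : Transcendental E₀ u) :
    False := by
  have hu0 : u ≠ 0 := by
    rintro rfl
    exact hu isAlgebraic_zero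
  let ι : E₀ →ₐ[ℂ] E := IsScalarTower.toAlgHom ℂ E₀ E
  let y₀ : Fin (M + k + 1) → E₀ := fun i => π (X i)
  let p₀ : Fin (M + k + 1) → E₀ := fun i => π (C (X i))
  let y : Fin (M + k + 1) → E := fun i => u * ι (y₀ i)
  let p : Fin (M + k + 1) → E := fun i => ι (p₀ i)
  have hy₀ : ∀ q : HomPoly (M + k), aeval y₀ q = π (map C q) := by
    intro q
    induction q using MvPolynomial.induction_on with
    | C a =>
      rw [map_C, ← algebraMap_eq, AlgHom.commutes]
      exact (π.commutes a).symm
    | add p q hp hq => simp only [map_add, hp, hq]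
    | mul_X q i hq => rw [map_mul, map_mul, map_mul, hq, aeval_X, map_X]
  have hyhom : ∀ (q : HomPoly (M + k)) (e : ℕ), q.IsHomogeneous e →
      aeval y q = u ^ e * ι (π (map C q)) := by
    intro q e hq
    rw [aeval_mul_left_of_isHomogeneous hq, ← hy₀, comp_aeval_apply]
  have hιj : ι (y₀ j) ≠ 0 := by
    rw [Ne, map_eq_zero]
    exact hj
  refine not_algebraicIndependent_of_polar hf hsmooth hfY hY hQ (E := E) (y := y) (p := p) (j := j)
    (mul_ne_zero hu0 hιj) (fun q hq => aeval_eq_zero_of_mem_ideal (fun q hq e he => ?_) hq) ?_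
    (fun i => ?_) ?_
  · rw [hyhom q e he, hle _ (Or.inl ⟨q, ⟨hq, e, he⟩, rfl⟩), map_zero, mul_zero]
  · rw [hyhom Q δ hQδ, hle _ (Or.inr (Or.inl rfl)), map_zero, mul_zero]
  · have h1 : π (polarForm (f i)) = 0 := hle _ (Or.inr (Or.inr ⟨i, rfl⟩))
    have h2 : ∑ l, jacRow f y i l * p l = u ^ (d i - 1) * ι (π (polarForm (f i))) := by
      rw [polarForm, map_sum, map_sum, Finset.mul_sum]
      refine Finset.sum_congr rfl fun l _ => ?_
      rw [jacRow, hyhom _ _ (hf i).pderiv, map_mul, map_mul, mul_assoc]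
    rw [h2, h1, map_zero, mul_zero]
  · have hp₀ : AlgebraicIndependent ℂ p₀ := by
      rw [algebraicIndependent_iff]
      intro a ha
      have h1 : aeval p₀ a = π (C a) := by
        have : aeval p₀ = π.comp (IsScalarTower.toAlgHom ℂ (HomPoly (M + k))
            (PolarRing (M + k))) := by
          refine MvPolynomial.algHom_ext fun i => ?_
          rw [aeval_X]
          rfl
        rw [this]
        rfl
      exact hC a (h1 ▸ ha)
    have hyj : AlgebraicIndependent E₀ fun _ : Unit => y j := by
      rw [algebraicIndependent_unique_type_iff]
      intro halg
      apply hu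
      have : u = y j * (ι (y₀ j))⁻¹ := by
        rw [mul_assoc, mul_inv_cancel₀ hιj, mul_one]
      rw [this]
      exact halg.mul (isAlgebraic_algebraMap (y₀ j)).inv
    have h1 := hp₀.sumElim_comp hyj
    have h2 := h1.comp (fun o : Option (Fin (M + k + 1)) => o.elim (Sum.inl ()) Sum.inr) (by
      rintro (_ | a) (_ | b) h <;> simp_all)
    have h3 : (fun o : Option (Fin (M + k + 1)) => o.elim (y j) p) =
        (Sum.elim (fun _ : Unit => y j) (algebraMap E₀ E ∘ p₀)) ∘
          (fun o : Option (Fin (M + k + 1)) => o.elim (Sum.inl ()) Sum.inr) := by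
      funext o
      cases o <;> rfl
    rw [h3]
    exact h2

/-- Otherwise some prime over the polar equations avoids all products `C a * X j ^ r` with `a ≠ 0`.
Its residue field carries a solution with generic direction and nonzero `j`-th coordinate, which is
impossible. -/
lemma exists_mul_X_pow_mem_span_polarEquations_single {M k : ℕ} {f : Fin k → HomPoly (M + k)}
    {d : Fin k → ℕ} (hf : ∀ i, (f i).IsHomogeneous (d i)) (hsmooth : IsSmoothCI f)
    {Y : ProjVariety (M + k)} (hfY : ∀ i, f i ∈ Y.ideal) (hY : Y.HasDim k) {Q : HomPoly (M + k)}
    {δ : ℕ} (hQδ : Q.IsHomogeneous δ) (hQ : Q ∉ Y.ideal) (j : Fin (M + k + 1)) :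
    ∃ (a : HomPoly (M + k)) (r : ℕ), a ≠ 0 ∧
      C a * X j ^ r ∈ Ideal.span (polarEquations f Y Q) := by
  by_contra! hcon
  let S : Submonoid (PolarRing (M + k)) :=
    { carrier := {z | ∃ (a : HomPoly (M + k)) (r : ℕ), a ≠ 0 ∧ z = C a * X j ^ r}
      one_mem' := ⟨1, 0, one_ne_zero, by simp⟩
      mul_mem' := by
        rintro _ _ ⟨a, r, ha, rfl⟩ ⟨b, s, hb, rfl⟩
        exact ⟨a * b, r + s, mul_ne_zero ha hb, by rw [C_mul, pow_add]; ring⟩ }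
  obtain ⟨P, hP, hle, hdisj⟩ := Ideal.exists_le_prime_disjoint
    (Ideal.span (polarEquations f Y Q)) S (by
      rw [Set.disjoint_left]
      rintro _ hz ⟨a, r, ha, rfl⟩
      exact hcon a r ha hz)
  rw [Set.disjoint_left] at hdisj
  let π : PolarRing (M + k) →ₐ[ℂ] FractionRing (PolarRing (M + k) ⧸ P) :=
    (IsScalarTower.toAlgHom ℂ (PolarRing (M + k) ⧸ P)
      (FractionRing (PolarRing (M + k) ⧸ P))).comp (Ideal.Quotient.mkₐ ℂ P)
  have hπ : ∀ z, π z = 0 ↔ z ∈ P := by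
    intro z
    rw [← Ideal.Quotient.eq_zero_iff_mem]
    exact map_eq_zero_iff (algebraMap (PolarRing (M + k) ⧸ P)
      (FractionRing (PolarRing (M + k) ⧸ P))) (IsFractionRing.injective _ _)
  refine false_of_polarEquations hf hsmooth hfY hY hQδ hQ (j := j) π
    (E := RatFunc (FractionRing (PolarRing (M + k) ⧸ P)))
    (fun z hz => (hπ z).mpr (hle (Ideal.subset_span hz))) (fun a ha => ?_) (fun h => ?_)
    (u := RatFunc.X) ?_
  · by_contra ha0
    exact hdisj ((hπ _).mp ha) ⟨a, 0, ha0, by simp⟩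
  · exact hdisj ((hπ _).mp h) ⟨1, 1, one_ne_zero, by simp⟩
  · exact RatFunc.transcendental_X

/-- For a generic direction, no point of `Y` satisfies the polar equations. -/
lemma exists_mul_X_pow_mem_span_polarEquations {M k : ℕ} {f : Fin k → HomPoly (M + k)}
    {d : Fin k → ℕ} (hf : ∀ i, (f i).IsHomogeneous (d i)) (hsmooth : IsSmoothCI f)
    {Y : ProjVariety (M + k)} (hfY : ∀ i, f i ∈ Y.ideal) (hY : Y.HasDim k) {Q : HomPoly (M + k)}
    {δ : ℕ} (hQδ : Q.IsHomogeneous δ) (hQ : Q ∉ Y.ideal) :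
    ∃ (a : HomPoly (M + k)) (r : ℕ), a ≠ 0 ∧
      ∀ j, C a * X j ^ r ∈ Ideal.span (polarEquations f Y Q) := by
  choose a r ha hr using
    exists_mul_X_pow_mem_span_polarEquations_single hf hsmooth hfY hY hQδ hQ
  refine ⟨∏ j, a j, ∑ j, r j, Finset.prod_ne_zero_iff.mpr fun j _ => ha j, fun j => ?_⟩
  rw [← Finset.mul_prod_erase _ _ (Finset.mem_univ j), ← Finset.add_sum_erase _ _
    (Finset.mem_univ j), C_mul, pow_add]
  have : C (a j) * C (∏ x ∈ Finset.univ.erase j, a x) *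
      (X j ^ r j * X j ^ ∑ x ∈ Finset.univ.erase j, r x) =
      (C (∏ x ∈ Finset.univ.erase j, a x) * X j ^ ∑ x ∈ Finset.univ.erase j, r x) *
        (C (a j) * X j ^ r j : PolarRing (M + k)) := by ring
  rw [this]
  exact Ideal.mul_mem_left _ _ (hr j)

end

/-! ### Behaviour at infinity and at the origin for a generic translation -/

section GenericDirection

variable {M k : ℕ} {A Ω : Type} [Field A] [Field Ω] [Algebra ℂ A] [Algebra ℂ Ω] [Algebra A Ω]
  [IsScalarTower ℂ A Ω]

lemma isHomogeneous_polarForm {N e : ℕ} {q : HomPoly N} (hq : q.IsHomogeneous e) :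
    (polarForm q).IsHomogeneous (e - 1) :=
  IsHomogeneous.sum _ _ _ fun l _ => by
    simpa using (hq.pderiv.map C).mul (isHomogeneous_C (Fin (N + 1)) (X l : HomPoly N))

/-- Modulo lower degree, a power of each coordinate is a multiple of `Q`. -/
lemma exists_pow_mem_map_sup_degFil {f : Fin k → HomPoly (M + k)} {d : Fin k → ℕ}
    (hd : ∀ i, 2 ≤ d i) (hf : ∀ i, (f i).IsHomogeneous (d i)) (hsmooth : IsSmoothCI f)
    {Y : ProjVariety (M + k)} (hfY : ∀ i, f i ∈ Y.ideal) (hY : Y.HasDim k) {Q : HomPoly (M + k)}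
    {δ : ℕ} (hQδ : Q.IsHomogeneous δ) (hQ : Q ∉ Y.ideal) {x y : Fin (M + k + 1) → Ω}
    {p : Fin (M + k + 1) → A} (hx : ∀ i, x i = y i + algebraMap A Ω (p i))
    (hp : AlgebraicIndependent ℂ p) (hxf : ∀ i, aeval x (f i) = 0)
    (hy : ∀ q ∈ Y.ideal, aeval y q = 0) :
    ∃ r : ℕ, ∀ j, y j ^ r ∈ (degFil A y (r - δ)).map (LinearMap.mulLeft A (aeval x Q)) ⊔
      degFil A y (r - 1) := by
  obtain ⟨a, r, ha, hr⟩ := exists_mul_X_pow_mem_span_polarEquations hf hsmooth hfY hY hQδ hQ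
  refine ⟨r, fun j => ?_⟩
  let φ : HomPoly (M + k) →+* A := (aeval p).toRingHom
  -- The direction is specialized to `p` and the point to `y`; degree in the point variables becomes
  -- degree in the filtration.
  let ev : PolarRing (M + k) →+* Ω := (aeval y : MvPolynomial _ A →ₐ[A] Ω).toRingHom.comp (map φ)
  have hevhom : ∀ (e : ℕ) (c : PolarRing (M + k)), c.IsHomogeneous e → ev c ∈ degFil A y e :=
    fun e c hc => aeval_mem_degFil (self_mem_degFil y) (hc.map φ)
  have hevmap : ∀ q : HomPoly (M + k), ev (map C q) = aeval y q := by
    intro q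
    change aeval y (map φ (map C q)) = _
    have : φ.comp C = algebraMap ℂ A := RingHom.ext fun c => by
      change aeval p (C c) = _
      rw [← algebraMap_eq, AlgHom.commutes]
    rw [map_map, this, aeval_map_algebraMap]
  have hevC : ∀ q : HomPoly (M + k), ev (C q) = algebraMap A Ω (aeval p q) := by
    intro q
    change aeval y (map φ (C q)) = _
    rw [map_C, ← algebraMap_eq, AlgHom.commutes]
    rfl
  have hevpolar : ∀ i, ev (polarForm (f i)) =
      ∑ l, aeval y (pderiv l (f i)) * algebraMap A Ω (p l) := by
    intro i
    rw [polarForm, map_sum]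
    refine Finset.sum_congr rfl fun l _ => ?_
    rw [map_mul, hevmap, hevC, aeval_X]
  let W : ℕ → Submodule A Ω := fun e =>
    (degFil A y (e - δ)).map (LinearMap.mulLeft A (aeval x Q)) ⊔ degFil A y (e - 1)
  have key := map_homogeneousComponent_mem_of_mem_span ev.toAddMonoidHom
    (fun e => (W e).toAddSubgroup) (polarEquations f Y Q) (by
      rintro _ (⟨q, ⟨hq, e, he⟩, rfl⟩ | rfl | ⟨i, rfl⟩)
      · refine ⟨e, he.map C, fun d₁ c _ => ?_⟩
        change ev (c * map C q) ∈ W _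
        rw [map_mul, hevmap, hy q hq, mul_zero]
        exact zero_mem _
      · refine ⟨δ, hQδ.map C, fun d₁ c hc => ?_⟩
        change ev (c * map C Q) ∈ W _
        -- The polar equations contain `Q(y)`, but multiples of `Q(x)` are wanted; the two differ by
        -- a term of lower degree.
        have h1 : ev (c * map C Q) = aeval x Q * ev c + -(ev c * (aeval x Q - aeval y Q)) := by
          rw [map_mul, hevmap]
          ring
        rw [h1]
        refine Submodule.add_mem_sup ⟨ev c, ?_, rfl⟩ (neg_mem ?_)
        · exact degFil_mono y (by push_cast; omega) (hevhom _ _ hc)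
        · exact mul_mem_degFil_of_eq (hevhom _ _ hc) (taylor_mem_degFil hx hQδ).1
            (by push_cast; omega)
      · refine ⟨d i - 1, isHomogeneous_polarForm (hf i), fun d₁ c hc => ?_⟩
        change ev (c * polarForm (f i)) ∈ W _
        -- Both `f i (x)` and `f i (y)` vanish, so the linear Taylor term equals minus the remainder
        -- and has degree `d i - 2`, one below its nominal degree.
        have h1 := (taylor_mem_degFil hx (hf i)).2
        rw [hxf, hy _ (hfY i), sub_zero, zero_sub, neg_mem_iff] at h1
        rw [map_mul, hevpolar]
        refine Submodule.mem_sup_right (mul_mem_degFil_of_eq (hevhom _ _ hc) h1 ?_)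
        have := hd i
        push_cast [show 1 ≤ d i by omega]
        omega) (hr j) r
  have hhom : (C a * X j ^ r : PolarRing (M + k)).IsHomogeneous r := by
    simpa using (isHomogeneous_C (Fin (M + k + 1)) a).mul
      ((isHomogeneous_X (HomPoly (M + k)) j).pow r)
  rw [homogeneousComponent_of_mem hhom, if_pos rfl] at key
  replace key : ev (C a * X j ^ r) ∈ W r := key
  -- Genericity of `p` makes the coefficient `a` a unit of the field `A`, so it can be divided out.
  have hpa : aeval p a ≠ 0 := fun h => ha (algebraicIndependent_iff.mp hp a h)
  have hevX : ev (X j) = y j := by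
    change aeval y (map φ (X j)) = _
    rw [map_X, aeval_X]
  rw [map_mul, hevC, map_pow, hevX, ← Algebra.smul_def] at key
  have := (W r).smul_mem (aeval p a)⁻¹ key
  rwa [smul_smul, inv_mul_cancel₀ hpa, one_smul] at this

/-- A translate of a cone does not meet the origin. -/
lemma exists_sum_mul_eq_one {N : ℕ} {x y : Fin (N + 1) → Ω}
    {p : Fin (N + 1) → A} (hx : ∀ i, x i = y i + algebraMap A Ω (p i))
    (hp : AlgebraicIndependent ℂ p) {u : HomPoly N} {e : ℕ} (hue : u.IsHomogeneous e) (hu : u ≠ 0)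
    (hyu : aeval y u = 0) :
    ∃ c : Fin (N + 1) → Ω, (∀ i, c i ∈ Algebra.adjoin A (Set.range y)) ∧
      ∑ i, x i * c i = 1 := by
  let B := Algebra.adjoin A (Set.range y)
  let y' : Fin (N + 1) → B := fun i => ⟨y i, Algebra.subset_adjoin ⟨i, rfl⟩⟩
  let x' : Fin (N + 1) → B := fun i => y' i + algebraMap A B (p i)
  have htop : Ideal.span (Set.range x') = ⊤ := by
    by_contra hne
    have : Nontrivial (B ⧸ Ideal.span (Set.range x')) := Ideal.Quotient.nontrivial_iff.mpr hne
    let π : B →ₐ[ℂ] B ⧸ Ideal.span (Set.range x') := Ideal.Quotient.mkₐ ℂ _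
    have h1 : aeval y' u = 0 := Subtype.ext (by
      have := comp_aeval_apply (R := ℂ) (f := y') (B.val.restrictScalars ℂ) u
      exact this.trans hyu)
    -- Where all the `x i` vanish, `y = -p`. A form vanishing at `y` would then vanish at `p`,
    -- against independence of its coordinates.
    have h2 : ∀ i, π (y' i) = algebraMap A _ ((-1) * p i) := by
      intro i
      have h3 : π (x' i) = 0 :=
        Ideal.Quotient.eq_zero_iff_mem.mpr (Ideal.subset_span ⟨i, rfl⟩)
      rw [map_add] at h3
      rw [neg_one_mul, map_neg]
      exact eq_neg_of_add_eq_zero_left h3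
    have h3 : algebraMap A (B ⧸ Ideal.span (Set.range x')) (aeval (fun i => (-1) * p i) u) = 0 := by
      rw [← aeval_algebraMap_apply]
      have := congrArg π h1
      rw [map_zero, comp_aeval_apply] at this
      simp only [h2] at this
      exact this
    rw [map_eq_zero, aeval_mul_left_of_isHomogeneous hue] at h3
    have h4 := (mul_eq_zero.mp h3).resolve_left (pow_ne_zero _ (by norm_num))
    exact hu (algebraicIndependent_iff.mp hp u h4)
  rw [Ideal.eq_top_iff_one, Ideal.mem_span_range_iff_exists_fun] at htop
  obtain ⟨c, hc⟩ := htop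
  refine ⟨fun i => c i, fun i => (c i).2, ?_⟩
  have := congrArg Subtype.val hc
  rw [AddSubmonoidClass.coe_finsetSum] at this
  simpa [x', y', hx, mul_comm] using this

end GenericDirection

/-! ### The generic fibre of the difference map -/

namespace ProjVariety

variable {N : ℕ}

/-- The field generated by the difference of the generic points of the two cones. -/
noncomputable abbrev diffField (X Z : ProjVariety N) : IntermediateField ℂ (X.prodField Z) :=
  IntermediateField.adjoin ℂ (Set.range fun i => X.genFst Z i - X.genSnd Z i)

/-- The difference of the generic points of the two cones. -/
noncomputable def genDiff (X Z : ProjVariety N) (i : Fin (N + 1)) : X.diffField Z :=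
  ⟨X.genFst Z i - X.genSnd Z i, IntermediateField.subset_adjoin _ _ ⟨i, rfl⟩⟩

lemma genFst_eq (X Z : ProjVariety N) (i : Fin (N + 1)) :
    X.genFst Z i = X.genSnd Z i + algebraMap (X.diffField Z) (X.prodField Z) (X.genDiff Z i) :=
  (add_sub_cancel _ _).symm

lemma genFst_mem_degFil (X Z : ProjVariety N) (i : Fin (N + 1)) :
    X.genFst Z i ∈ degFil (X.diffField Z) (X.genSnd Z) 1 := by
  rw [genFst_eq]
  exact add_mem (self_mem_degFil _ i) (algebraMap_mem_degFil _ _ zero_le_one)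

lemma mem_of_forall_gen_mem {X Z : ProjVariety N} {S : Set (X.prodField Z)}
    (hx : ∀ i, X.genFst Z i ∈ algClosureSubfield S) (hy : ∀ i, X.genSnd Z i ∈ algClosureSubfield S)
    (w : X.prodField Z) : w ∈ algClosureSubfield S := by
  have h : ∀ b : MvPolynomial (Fin (N + 1) ⊕ Fin (N + 1)) ℂ ⧸ X.prodIdeal Z,
      algebraMap _ (X.prodField Z) b ∈ algClosureSubfield S := by
    intro b
    obtain ⟨q, rfl⟩ := Ideal.Quotient.mk_surjective b
    rw [← aeval_gen_eq]
    refine aeval_mem_algClosureSubfield (fun i => ?_) q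
    cases i
    · exact hx _
    · exact hy _
  obtain ⟨a, b, -, rfl⟩ := IsFractionRing.div_surjective
    (A := MvPolynomial (Fin (N + 1) ⊕ Fin (N + 1)) ℂ ⧸ X.prodIdeal Z) w
  exact div_mem (h a) (h b)

/-- A form of degree `n` on a smooth complete intersection vanishes to order at most `n` along a
subvariety whose dimension is the number of equations. -/
theorem le_of_mul_mem_degFil {M k : ℕ} (hk : 0 < k) {f : Fin k → HomPoly (M + k)} {d : Fin k → ℕ}
    (hd : ∀ i, 2 ≤ d i) (hf : ∀ i, (f i).IsHomogeneous (d i)) (hf0 : ∀ i, f i ≠ 0)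
    (hsmooth : IsSmoothCI f) {F Y : ProjVariety (M + k)}
    (hF : F.carrier = projZeros (Set.range f)) (hFdim : F.HasDim M)
    (hYF : Y.carrier ⊆ F.carrier) (hY : Y.HasDim k)
    (hfF : ∀ i, f i ∈ F.ideal) (hfY : ∀ i, f i ∈ Y.ideal)
    {g : F.prodField Y} (hg0 : g ≠ 0) {Q : HomPoly (M + k)} {n m s δ : ℕ}
    (hQδ : Q.IsHomogeneous δ) (hQ : Q ∉ Y.ideal)
    (hQg : aeval (F.genFst Y) Q * g ∈ degFil (F.diffField Y) (F.genSnd Y) (δ + n - m))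
    (hg : ∀ j, F.genFst Y j ^ s * g ∈ degFil (F.diffField Y) (F.genSnd Y) (s + n)) : m ≤ n := by
  by_contra! hnm
  have hind := algebraicIndependent_genFst_sub_genSnd hd hf hsmooth hF hYF hY
  have hp : AlgebraicIndependent ℂ (F.genDiff Y) :=
    AlgebraicIndependent.of_comp (F.diffField Y).val hind
  obtain ⟨r, hr⟩ := exists_pow_mem_map_sup_degFil hd hf hsmooth hfY hY hQδ hQ (F.genFst_eq Y) hp
    (fun i => aeval_genFst_eq_zero.mpr (hfF i)) fun q hq => aeval_genSnd_eq_zero.mpr hq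
  obtain ⟨c, hc, hsum⟩ := exists_sum_mul_eq_one (F.genFst_eq Y) hp (hf ⟨0, hk⟩) (hf0 _)
    (aeval_genSnd_eq_zero.mpr (hfY _))
  have halg := isAlgebraic_of_vanishing (F.genFst_eq Y) hg0 hnm hQg hr hg hc hsum
  let S : Set (F.prodField Y) := Set.range fun i => F.genFst Y i - F.genSnd Y i
  have hyS : ∀ i, F.genSnd Y i ∈ algClosureSubfield S := fun i =>
    mem_algClosureSubfield_of_isAlgebraic_adjoin (halg i)
  have hxS : ∀ i, F.genFst Y i ∈ algClosureSubfield S := fun i => by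
    rw [genFst_eq]
    exact add_mem (hyS i) (subset_algClosureSubfield ⟨i, rfl⟩)
  -- The function field of the product has `(M + 1) + (k + 1)` independent elements, yet it is now
  -- algebraic over the `M + k + 1` coordinate differences.
  obtain ⟨w, hw⟩ := exists_algebraicIndependent_prodField hFdim hY
  have h1 := card_le_eRk hw fun i => mem_of_forall_gen_mem hxS hyS (w i)
  have h2 : (AlgebraicIndependent.matroid ℂ (F.prodField Y)).eRk S ≤ (M + k + 1 : ℕ) := by
    refine (Matroid.eRk_le_encard _ _).trans ?_
    simp only [S]
    rw [← Set.image_univ]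
    refine (Set.encard_image_le _ _).trans ?_
    simp
  have h3 := h1.trans h2
  simp only [Fintype.card_sum, Fintype.card_fin] at h3
  have h4 : M + 1 + (k + 1) ≤ M + k + 1 := by exact_mod_cast h3
  omega

end ProjVariety

/-! ### Determinants and alternating maps -/

noncomputable section

section FrameDeterminants

variable {K : Type*} [Field K] [Algebra ℂ K] {M k : ℕ}

lemma rowDet_frame_update [DecidableEq (Fin M)] (f : Fin k → HomPoly (M + k))
    (z u : Fin (M + k + 1) → K) (v : Fin M → Fin (M + k + 1) → K) (r : Fin M)
    (x : Fin (M + k + 1) → K) :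
    rowDet (frame f z u (Function.update v r x)) =
      (Matrix.updateRow (Matrix.of fun a b => frame f z u v a (frameRowEquiv k M b)) (Sum.inr r)
        (x ∘ frameRowEquiv k M)).det := by
  rw [rowDet]
  congr 1
  ext a b
  rcases a with (i | _) | t
  · rw [Matrix.updateRow_ne Sum.inl_ne_inr]
    rfl
  · rw [Matrix.updateRow_ne Sum.inl_ne_inr]
    rfl
  · change Function.update v r x t (frameRowEquiv k M b) = _
    by_cases h : t = r
    · subst h
      rw [Matrix.updateRow_self, Function.update_self]
      rfl
    · rw [Matrix.updateRow_ne fun h' => h (Sum.inr_injective h'), Function.update_of_ne h]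
      rfl

/-- The determinant of the Jacobian rows and the row `u`, completed by `M` further rows, as an
alternating map of these. -/
def frameAlt (f : Fin k → HomPoly (M + k)) (z u : Fin (M + k + 1) → K) :
    (Fin (M + k + 1) → K) [⋀^Fin M]→ₗ[K] K where
  toFun v := rowDet (frame f z u v)
  map_update_add' := by
    intro _ v r x y
    rw [rowDet_frame_update, rowDet_frame_update, rowDet_frame_update, ← Matrix.det_updateRow_add]
    rfl
  map_update_smul' := by
    intro _ v r c x
    rw [rowDet_frame_update, rowDet_frame_update, smul_eq_mul, ← Matrix.det_updateRow_smul]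
    rfl
  map_eq_zero_of_eq' := by
    intro v r r' h hne
    refine Matrix.det_zero_of_row_eq (i := Sum.inr r) (j := Sum.inr r') (by simpa using hne) ?_
    funext b
    simp [frame, h]

lemma frameAlt_apply (f : Fin k → HomPoly (M + k)) (z u : Fin (M + k + 1) → K)
    (v : Fin M → Fin (M + k + 1) → K) : frameAlt f z u v = rowDet (frame f z u v) := rfl

/-- An alternating map that vanishes on the Jacobian rows and on the row `u` is a multiple of a
determinant. -/
lemma rowDet_smul_eq {W : Type*} [AddCommGroup W] [Module K W] {f : Fin k → HomPoly (M + k)}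
    {z u : Fin (M + k + 1) → K} {w : Fin M → Fin (M + k + 1) → K}
    (hdet : rowDet (frame f z u w) ≠ 0)
    (Ψ : (Fin (M + k + 1) → K) [⋀^Fin M]→ₗ[K] W)
    (hJ : ∀ v r i, v r = jacRow f z i → Ψ v = 0) (hu : ∀ v r, v r = u → Ψ v = 0)
    (v : Fin M → Fin (M + k + 1) → K) :
    rowDet (frame f z u v) • Ψ w = rowDet (frame f z u w) • Ψ v := by
  have hli := rowDet_ne_zero_iff.mp hdet
  let b := basisOfLinearIndependentOfCardEqFinrank hli (by simp; omega)
  have hb : ∀ a, b a = frame f z u w a := fun a => by simp [b]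
  have hext : (LinearMap.toSpanSingleton K W (Ψ w)).compAlternatingMap (frameAlt f z u) =
      rowDet (frame f z u w) • Ψ := by
    refine Module.Basis.ext_alternating b fun c hc => ?_
    change rowDet (frame f z u fun r => b (c r)) • Ψ w =
      rowDet (frame f z u w) • Ψ fun r => b (c r)
    -- On a tuple of distinct basis vectors, either a Jacobian row or `u` occurs and both sides
    -- vanish, or the tuple is a permutation of `w` and both sides acquire the same sign.
    by_cases h : ∃ r a, c r = Sum.inl a
    · obtain ⟨r, a, ha⟩ := h
      have h1 : rowDet (frame f z u fun r => b (c r)) = 0 := by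
        refine Matrix.det_zero_of_row_eq (i := Sum.inl a) (j := Sum.inr r) (by simp) ?_
        funext t
        simp [frame, hb, ha]
      have h2 : Ψ (fun r => b (c r)) = 0 := by
        rcases a with i | _
        · exact hJ _ r i (by rw [ha, hb]; rfl)
        · exact hu _ r (by rw [ha, hb]; rfl)
      rw [h1, h2, zero_smul, smul_zero]
    · have h1 : ∀ r, ∃ t, c r = Sum.inr t := by
        intro r
        rcases hcr : c r with a | t
        · exact (h ⟨r, a, hcr⟩).elim
        · exact ⟨t, rfl⟩
      choose τ hτ using h1
      have hinj : Function.Injective τ := fun r r' hrr => hc (by rw [hτ, hτ, hrr])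
      let σ : Equiv.Perm (Fin M) := Equiv.ofBijective τ (Finite.injective_iff_bijective.mp hinj)
      have h2 : (fun r => b (c r)) = w ∘ σ := by
        funext r
        rw [hτ, hb]
        rfl
      rw [h2, ← frameAlt_apply, AlternatingMap.map_perm, AlternatingMap.map_perm, frameAlt_apply,
        smul_assoc, smul_comm]
  exact congrArg (fun φ => φ v) hext

/-- Replacement of the row `u` for rows that vanish on `z`. -/
lemma rowDet_frame_mul {f : Fin k → HomPoly (M + k)} {z u : Fin (M + k + 1) → K}
    {v : Fin M → Fin (M + k + 1) → K} (hJ : ∀ i, ∑ l, jacRow f z i l * z l = 0)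
    (hv : ∀ r, ∑ l, v r l * z l = 0) (j : Fin (M + k + 1)) :
    rowDet (frame f z u v) * z j =
      rowDet (frame f z (Pi.single j 1) v) * ∑ l, u l * z l := by
  let A : Matrix (FrameRow k M) (FrameRow k M) K :=
    Matrix.of fun a b => frame f z u v a (frameRowEquiv k M b)
  -- All rows except `u` annihilate `z`. Applying the adjugate leaves one cofactor, the determinant
  -- with `u` replaced by the `j`-th coordinate row.
  have hA : A.mulVec (z ∘ frameRowEquiv k M) =
      Pi.single (Sum.inl (Sum.inr ())) (∑ l, u l * z l) := by
    funext a
    have h1 : A.mulVec (z ∘ frameRowEquiv k M) a = ∑ c, frame f z u v a c * z c :=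
      (frameRowEquiv k M).sum_comp fun c => frame f z u v a c * z c
    rw [h1]
    rcases a with (i | _) | r
    · simpa [frame] using hJ i
    · simp [frame]
    · simpa [frame] using hv r
  have h1 : A.adjugate.mulVec (A.mulVec (z ∘ frameRowEquiv k M)) =
      A.det • (z ∘ frameRowEquiv k M) := by
    rw [Matrix.mulVec_mulVec, Matrix.adjugate_mul, Matrix.smul_mulVec, Matrix.one_mulVec]
  have h2 := congrFun h1 ((frameRowEquiv k M).symm j)
  rw [hA, Matrix.mulVec_single, Pi.smul_apply, Pi.smul_apply, Function.comp_apply,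
    Equiv.apply_symm_apply, smul_eq_mul] at h2
  rw [rowDet]
  refine h2.symm.trans ?_
  rw [Matrix.col_apply, Matrix.adjugate_apply, op_smul_eq_mul]
  congr 1
  rw [rowDet]
  congr 1
  ext a b
  rcases a with (i | _) | r
  · simp [A, frame, Matrix.updateRow_apply]
  · simp [A, frame, Matrix.updateRow_apply, Pi.single_apply, Equiv.eq_symm_apply]
  · simp [A, frame, Matrix.updateRow_apply]

lemma rowDet_frame_smul_sub (f : Fin k → HomPoly (M + k)) (z u : Fin (M + k + 1) → K)
    (w : Fin M → Fin (M + k + 1) → K) (a : K) (b : Fin M → K) :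
    rowDet (frame f z u fun r => a • (w r - b r • u)) = a ^ M * rowDet (frame f z u w) := by
  have h1 : rowDet (frame f z u fun r => a • (w r - b r • u)) =
      a ^ M * rowDet (frame f z u fun r => w r - b r • u) := by
    have := (frameAlt f z u).toMultilinearMap.map_smul_univ (fun _ => a) fun r => w r - b r • u
    rw [Finset.prod_const, Finset.card_univ, Fintype.card_fin] at this
    exact this
  rw [h1]
  congr 1
  refine Matrix.det_eq_of_forall_row_eq_smul_add_const
    (Sum.elim (fun _ => 0) fun r => - b r) (Sum.inl (Sum.inr ())) rfl fun a t => ?_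
  rcases a with (i | _) | r
  · simp [frame]
  · simp [frame]
  · simp [frame]
    ring

end FrameDeterminants

/-! ### Rational forms of top degree and the residue form -/

section TopForms

variable {K : Type} [Field K] [Algebra ℂ K]

/-- The linear map that sends the coordinate vectors to the differentials of the `z l`. -/
def coordDiff {N : ℕ} (z : Fin (N + 1) → K) : (Fin (N + 1) → K) →ₗ[K] Ω[K⁄ℂ] :=
  Fintype.linearCombination K fun l => KaehlerDifferential.D ℂ K (z l)

lemma coordDiff_single {N : ℕ} (z : Fin (N + 1) → K) (l : Fin (N + 1)) :
    coordDiff z (Pi.single l 1) = KaehlerDifferential.D ℂ K (z l) := by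
  rw [coordDiff, Fintype.linearCombination_apply_single, one_smul]

lemma coordDiff_pderiv {N : ℕ} (z : Fin (N + 1) → K) (q : HomPoly N) :
    coordDiff z (fun l => aeval z (pderiv l q)) = KaehlerDifferential.D ℂ K (aeval z q) := by
  induction q using MvPolynomial.induction_on with
  | C a =>
    rw [← algebraMap_eq, AlgHom.commutes, Derivation.map_algebraMap]
    have : (fun l => aeval z (pderiv l (algebraMap ℂ (HomPoly N) a))) = 0 := by
      funext l
      simp
    rw [this, map_zero]
  | add p q hp hq =>
    rw [map_add, map_add, ← hp, ← hq, ← map_add]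
    congr 1
    funext l
    simp
  | mul_X p i hp =>
    rw [map_mul, aeval_X, Derivation.leibniz, ← hp, ← coordDiff_single z i, ← map_smul, ← map_smul,
      ← map_add]
    congr 1
    funext l
    rw [Derivation.leibniz, pderiv_X]
    by_cases h : l = i
    · subst h; simp
    · simp [h, Ne.symm h]

/-- By the quotient rule, differentials of coordinates that generate the field span all
differentials. -/
lemma coordDiff_surjective {N : ℕ} {z : Fin (N + 1) → K}
    (hgen : ∀ a : K, ∃ p q : HomPoly N, a = aeval z p / aeval z q) :
    Function.Surjective (coordDiff z) := by
  rw [← LinearMap.range_eq_top, eq_top_iff, ← KaehlerDifferential.span_range_derivation,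
    Submodule.span_le]
  rintro _ ⟨a, rfl⟩
  obtain ⟨p, q, rfl⟩ := hgen a
  rw [Derivation.leibniz_div, ← coordDiff_pderiv, ← coordDiff_pderiv]
  exact Submodule.smul_mem _ _ (sub_mem (Submodule.smul_mem _ _ ⟨_, rfl⟩)
    (Submodule.smul_mem _ _ ⟨_, rfl⟩))

variable {M k : ℕ} {f : Fin k → HomPoly (M + k)} {d : Fin k → ℕ}

/-- On a smooth complete intersection, the rational forms of top degree are the multiples of the
residue form. -/
lemma exists_generator_topForms (hf : ∀ i, (f i).IsHomogeneous (d i)) (hsmooth : IsSmoothCI f)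
    {z : Fin (M + k + 1) → K} (hzf : ∀ i, aeval z (f i) = 0) {j₀ : Fin (M + k + 1)}
    (hj₀ : z j₀ = 1)
    (hgen : ∀ a : K, ∃ p q : HomPoly (M + k), a = aeval z p / aeval z q) :
    ∃ η : ⋀[K]^M (Ω[K⁄ℂ]), (∀ w, ∃ c : K, w = c • η) ∧
      ∀ (j : Fin (M + k + 1)) (l : Fin M → Fin (M + k + 1)), z j ≠ 0 →
        exteriorPower.ιMulti K M (fun r => KaehlerDifferential.D ℂ K (z (l r) / z j)) =
          (jacDet f z j l * (z j ^ (M + 1))⁻¹) • η := by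
  obtain ⟨l₀, hl₀⟩ := exists_jacDet_ne_zero_of_field hf hsmooth hzf (j := j₀)
    (by rw [hj₀]; exact one_ne_zero)
  -- This map vanishes on the Jacobian rows since `d(f i) = 0`, and on the row of `j₀` since `z j₀ =
  -- 1` is constant. It is therefore a determinant times a fixed form, the residue form.
  let Ψ : (Fin (M + k + 1) → K) [⋀^Fin M]→ₗ[K] ⋀[K]^M (Ω[K⁄ℂ]) :=
    (exteriorPower.ιMulti K M).compLinearMap (coordDiff z)
  have hΨ : ∀ v r, coordDiff z (v r) = 0 → Ψ v = 0 := fun v r h =>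
    (exteriorPower.ιMulti K M).map_coord_zero r h
  let w₀ : Fin M → Fin (M + k + 1) → K := fun r => Pi.single (l₀ r) 1
  have key : ∀ v, Ψ v = rowDet (frame f z (Pi.single j₀ 1) v) •
      ((jacDet f z j₀ l₀)⁻¹ • Ψ w₀) := by
    intro v
    have h := rowDet_smul_eq (f := f) (z := z) (u := Pi.single j₀ 1) (w := w₀) hl₀ Ψ
      (fun v r i h => hΨ v r (by
        rw [h]
        refine (coordDiff_pderiv z (f i)).trans ?_
        rw [hzf, map_zero]))
      (fun v r h => hΨ v r (by
        rw [h, coordDiff_single, hj₀]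
        exact Derivation.map_one_eq_zero _)) v
    rw [smul_comm, h, smul_smul]
    change _ = ((jacDet f z j₀ l₀)⁻¹ * jacDet f z j₀ l₀) • _
    rw [inv_mul_cancel₀ hl₀, one_smul]
  refine ⟨(jacDet f z j₀ l₀)⁻¹ • Ψ w₀, fun w => ?_, fun j l hj => ?_⟩
  · suffices h : (⊤ : Submodule K (⋀[K]^M (Ω[K⁄ℂ]))) ≤
        Submodule.span K {(jacDet f z j₀ l₀)⁻¹ • Ψ w₀} by
      obtain ⟨c, hc⟩ := Submodule.mem_span_singleton.mp (h (Submodule.mem_top (x := w)))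
      exact ⟨c, hc.symm⟩
    rw [← exteriorPower.ιMulti_span, Submodule.span_le]
    rintro _ ⟨ω, rfl⟩
    choose v hv using fun r => coordDiff_surjective hgen (ω r)
    have : exteriorPower.ιMulti K M ω = Ψ v := by
      change _ = exteriorPower.ιMulti K M fun r => coordDiff z (v r)
      rw [funext hv]
    rw [this, key v]
    exact Submodule.mem_span_singleton.mpr ⟨_, rfl⟩
  -- The quotient rule for `z (l r) / z j`, written as a row. These rows annihilate `z`, because the
  -- quotients have degree zero.
  · let v : Fin M → Fin (M + k + 1) → K := fun r =>
      (z j)⁻¹ • (Pi.single (l r) 1 - (z (l r) / z j) • Pi.single j 1)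
    have h1 : exteriorPower.ιMulti K M (fun r => KaehlerDifferential.D ℂ K (z (l r) / z j)) =
        Ψ v := by
      change _ = exteriorPower.ιMulti K M fun r => coordDiff z (v r)
      congr 1
      funext r
      rw [Derivation.leibniz_div, map_smul, map_sub, map_smul, coordDiff_single, coordDiff_single,
        smul_sub, smul_sub, smul_smul, smul_smul, smul_smul]
      congr 2 <;> field_simp
    rw [h1, key v]
    congr 1
    -- The exponent `M + 1`: one factor `(z j)⁻¹` from each of the `M` rows, and one from exchanging
    -- the coordinate row of `j₀` for that of `j`.
    have h2 := rowDet_frame_mul (f := f) (z := z) (u := Pi.single j₀ 1) (v := v)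
      (euler_jacRow hf hzf) (fun r => by
        simp only [v, Pi.smul_apply, Pi.sub_apply, smul_eq_mul, mul_assoc, sub_mul]
        rw [← Finset.mul_sum, Finset.sum_sub_distrib, ← Finset.mul_sum]
        simp [Pi.single_apply, hj]) j
    rw [rowDet_frame_smul_sub] at h2
    have h3 : ∑ l, (Pi.single j₀ 1 : Fin (M + k + 1) → K) l * z l = 1 := by
      simp [Pi.single_apply, hj₀]
    rw [h3, mul_one] at h2
    rw [eq_div_of_mul_eq hj h2, jacDet, pow_succ, mul_inv, inv_pow]
    field_simp

/-- The value of a section of a power of the dual of the sheaf of top forms on the forms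
`d(z_l / z_j)`. -/
lemma RatSections.exists_onWedges_eq (hf : ∀ i, (f i).IsHomogeneous (d i)) (hsmooth : IsSmoothCI f)
    {z : Fin (M + k + 1) → K} (hzf : ∀ i, aeval z (f i) = 0) {j₀ : Fin (M + k + 1)}
    (hj₀ : z j₀ = 1)
    (hgen : ∀ a : K, ∃ p q : HomPoly (M + k), a = aeval z p / aeval z q)
    {n : ℕ} {s : RatSections K M n} (hs : s ≠ 0) :
    ∃ h : K, h ≠ 0 ∧ ∀ (j : Fin (M + k + 1)) (l : Fin M → Fin (M + k + 1)), z j ≠ 0 →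
      s.onWedges (fun _ r => z (l r) / z j) = (jacDet f z j l * (z j ^ (M + 1))⁻¹) ^ n * h := by
  obtain ⟨η, hη, hjl⟩ := exists_generator_topForms hf hsmooth hzf hj₀ hgen
  let t : MultilinearMap K (fun _ : Fin n => ⋀[K]^M (Ω[K⁄ℂ])) K := s
  have hsmul : ∀ c : Fin n → K, t (fun i => c i • η) = (∏ i, c i) * t fun _ => η :=
    fun c => t.map_smul_univ c fun _ => η
  refine ⟨t fun _ => η, fun h0 => hs ?_, fun j l hj => ?_⟩
  · have : t = 0 := by
      refine MultilinearMap.ext fun w => ?_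
      choose c hc using fun i => hη (w i)
      rw [funext hc, hsmul, h0, mul_zero]
      rfl
    exact this
  · change t (fun _ => exteriorPower.ιMulti K M
      fun r => KaehlerDifferential.D ℂ K (z (l r) / z j)) = _
    rw [hjl j l hj, hsmul, Finset.prod_const, Finset.card_univ, Fintype.card_fin]

end TopForms

end

/-! ### Sections as forms on the cone, and the multiplicity bound -/

noncomputable section

namespace ProjVariety

variable {N : ℕ}

lemma ideal_le_ideal {X Z : ProjVariety N} (h : Z.carrier ⊆ X.carrier) : X.ideal ≤ Z.ideal := by
  intro q hq
  rw [mem_ideal] at hq ⊢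
  rintro v ⟨hv, hvZ⟩
  exact hq v ⟨hv, h hvZ⟩

/-- A point of projective space, as a variety. -/
def point (p : PSpace N) : ProjVariety N where
  carrier := {p}
  isAlgebraicSet := by
    refine ⟨Set.range fun a : Fin (N + 1) × Fin (N + 1) =>
      C (p.rep a.1) * X a.2 - C (p.rep a.2) * X a.1, ?_, ?_⟩
    · rintro _ ⟨a, rfl⟩
      have h : ∀ (c : ℂ) (i : Fin (N + 1)), (C c * X i : HomPoly N).IsHomogeneous 1 := fun c i => by
        simpa using (isHomogeneous_C (Fin (N + 1)) c).mul (isHomogeneous_X ℂ i)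
      exact ⟨1, (h _ _).sub (h _ _)⟩
    · ext q
      constructor
      · rintro rfl _ ⟨a, rfl⟩
        simp
        ring
      · intro hq
        obtain ⟨j, hj⟩ := Function.ne_iff.mp p.rep_nonzero
        have h : q.rep = (q.rep j / p.rep j) • p.rep := by
          funext i
          have h1 := hq _ ⟨(j, i), rfl⟩
          simp only [map_sub, map_mul, eval_C, eval_X] at h1
          rw [Pi.smul_apply, smul_eq_mul, div_mul_eq_mul_div, eq_div_iff hj]
          linear_combination h1
        rw [Set.mem_singleton_iff, ← q.mk_rep, ← p.mk_rep, Projectivization.mk_eq_mk_iff']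
        exact ⟨_, h.symm⟩
  nonempty := ⟨p, rfl⟩
  irreducible := fun _ _ _ _ h => (h rfl).imp (fun h => by rintro _ rfl; exact h)
    fun h => by rintro _ rfl; exact h

lemma toConeField_eq_aeval (X : ProjVariety N) (q : HomPoly N) :
    X.toConeField q = aeval (fun l => X.toConeField (MvPolynomial.X l)) q := by
  induction q using MvPolynomial.induction_on with
  | C a => rw [toConeField_C, ← algebraMap_eq, AlgHom.commutes]
  | add p q hp hq => simp only [map_add, hp, hq]
  | mul_X q i hq => rw [map_mul, map_mul, hq, aeval_X]

/-- The embedding of the function field of the first cone into that of the product. -/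
def fstHom (X Z : ProjVariety N) : X.coneField →+* X.prodField Z :=
  IsFractionRing.lift (A := X.coordRing)
    (g := Ideal.Quotient.lift X.ideal (aeval (X.genFst Z) : HomPoly N →ₐ[ℂ] X.prodField Z).toRingHom
      fun _ hq => aeval_genFst_eq_zero.mpr hq)
    (by
      rw [injective_iff_map_eq_zero]
      intro a ha
      obtain ⟨q, rfl⟩ := Ideal.Quotient.mk_surjective a
      rw [Ideal.Quotient.lift_mk] at ha
      exact Ideal.Quotient.eq_zero_iff_mem.mpr (aeval_genFst_eq_zero.mp ha))

lemma fstHom_toConeField (X Z : ProjVariety N) (q : HomPoly N) :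
    X.fstHom Z (X.toConeField q) = aeval (X.genFst Z) q := by
  rw [toConeField, RingHom.comp_apply, fstHom, IsFractionRing.lift_algebraMap]
  rfl

/-- The functions on `X` that have, up to a form not vanishing on `Z`, degree at most `-m` in the
second generic point. -/
def filIdeal (X Z : ProjVariety N) (m : ℕ) : Ideal (X.localRing Z) where
  carrier := {q | ∃ (δ : ℕ) (b : HomPoly N), b.IsHomogeneous δ ∧ b ∉ Z.ideal ∧
    aeval (X.genFst Z) b * X.fstHom Z (q : X.functionField) ∈
      degFil (X.diffField Z) (X.genSnd Z) (δ - m)}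
  zero_mem' := ⟨0, 1, isHomogeneous_one _ _, Z.isPrime_ideal.one_notMem, by simp⟩
  add_mem' := by
    rintro q q' ⟨δ, b, hb, hbZ, h⟩ ⟨δ', b', hb', hbZ', h'⟩
    refine ⟨δ + δ', b * b', hb.mul hb', Z.isPrime_ideal.mul_notMem hbZ hbZ', ?_⟩
    have : aeval (X.genFst Z) (b * b') * X.fstHom Z ((q + q' : X.localRing Z) : X.functionField) =
        aeval (X.genFst Z) b' * (aeval (X.genFst Z) b * X.fstHom Z (q : X.functionField)) +
          aeval (X.genFst Z) b * (aeval (X.genFst Z) b' * X.fstHom Z (q' : X.functionField)) := by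
      push_cast
      rw [RingHom.map_add, map_mul]
      ring
    rw [this]
    exact add_mem
      (mul_mem_degFil_of_eq (aeval_mem_degFil (X.genFst_mem_degFil Z) hb') h (by push_cast; omega))
      (mul_mem_degFil_of_eq (aeval_mem_degFil (X.genFst_mem_degFil Z) hb) h' (by push_cast; omega))
  smul_mem' := by
    rintro r q ⟨δ, b, hb, hbZ, h⟩
    obtain ⟨e, a, c, ha, hc, hcX, hcZ, hr⟩ := r.2
    refine ⟨δ + e, b * c, hb.mul hc, Z.isPrime_ideal.mul_notMem hbZ hcZ, ?_⟩
    have hc0 : aeval (X.genFst Z) c ≠ 0 := fun h => hcX (aeval_genFst_eq_zero.mp h)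
    have hr' : X.fstHom Z (r : X.functionField) =
        aeval (X.genFst Z) a / aeval (X.genFst Z) c := by
      rw [← fstHom_toConeField, ← fstHom_toConeField, ← map_div₀]
      exact congrArg _ hr
    have : aeval (X.genFst Z) (b * c) * X.fstHom Z ((r • q : X.localRing Z) : X.functionField) =
        aeval (X.genFst Z) a * (aeval (X.genFst Z) b * X.fstHom Z (q : X.functionField)) := by
      rw [smul_eq_mul]
      push_cast
      rw [map_mul, map_mul, hr']
      field_simp
    rw [this]
    exact mul_mem_degFil_of_eq (aeval_mem_degFil (X.genFst_mem_degFil Z) ha) h (by push_cast; omega)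

lemma exists_mul_eq_of_localRing {X Z : ProjVariety N} (W : ProjVariety N) (q : X.localRing Z) :
    ∃ (m : ℕ) (a b : HomPoly N), a.IsHomogeneous m ∧ b.IsHomogeneous m ∧ b ∉ Z.ideal ∧
      aeval (X.genFst W) b * X.fstHom W (q : X.functionField) = aeval (X.genFst W) a := by
  obtain ⟨m, a, b, ha, hb, hbX, hbZ, hq⟩ := q.2
  refine ⟨m, a, b, ha, hb, hbZ, ?_⟩
  have hb0 : X.toConeField b ≠ 0 := fun h => hbX (toConeField_eq_zero.mp h)
  replace hq : ((q : X.functionField) : X.coneField) = X.toConeField a / X.toConeField b := hq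
  rw [hq, ← fstHom_toConeField, ← fstHom_toConeField, ← map_mul, mul_div_cancel₀ _ hb0]

/-- If `a` vanishes on `Z`, its value at the second generic point is zero, so the leading term in
the Taylor expansion of its value at the first one disappears. -/
lemma maxIdealAlong_le_filIdeal (X Z : ProjVariety N) : X.maxIdealAlong Z ≤ X.filIdeal Z 1 := by
  refine Ideal.span_le.mpr ?_
  rintro q ⟨e, a, b, ha, hb, haZ, hbX, hbZ, hq⟩
  refine ⟨e, b, hb, hbZ, ?_⟩
  have hb0 : X.toConeField b ≠ 0 := fun h => hbX (toConeField_eq_zero.mp h)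
  rw [hq, ← fstHom_toConeField, ← map_mul, mul_div_cancel₀ _ hb0, fstHom_toConeField]
  have h := (taylor_mem_degFil (X.genFst_eq Z) ha).1
  rwa [aeval_genSnd_eq_zero.mpr haZ, sub_zero] at h

/-- The drops in degree add under multiplication. This translates order of vanishing along `Z` into
degree at infinity. -/
lemma maxIdealAlong_pow_le_filIdeal (X Z : ProjVariety N) (m : ℕ) :
    X.maxIdealAlong Z ^ m ≤ X.filIdeal Z m := by
  induction m with
  | zero =>
    intro q _
    obtain ⟨m, a, b, ha, hb, hbZ, h⟩ := exists_mul_eq_of_localRing Z q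
    refine ⟨m, b, hb, hbZ, ?_⟩
    rw [h]
    exact degFil_mono _ (by simp) (aeval_mem_degFil (X.genFst_mem_degFil Z) ha)
  | succ m ih =>
    rw [pow_succ, Ideal.mul_le]
    intro q hq q' hq'
    obtain ⟨δ, b, hb, hbZ, h⟩ := ih hq
    obtain ⟨δ', b', hb', hbZ', h'⟩ := X.maxIdealAlong_le_filIdeal Z hq'
    refine ⟨δ + δ', b * b', hb.mul hb', Z.isPrime_ideal.mul_notMem hbZ hbZ', ?_⟩
    have : aeval (X.genFst Z) (b * b') * X.fstHom Z ((q * q' : X.localRing Z) : X.functionField) =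
        (aeval (X.genFst Z) b * X.fstHom Z (q : X.functionField)) *
          (aeval (X.genFst Z) b' * X.fstHom Z (q' : X.functionField)) := by
      push_cast
      rw [map_mul, map_mul]
      ring
    rw [this]
    exact mul_mem_degFil_of_eq h h' (by push_cast; omega)

/-- The affine coordinates in the chart `{x_j ≠ 0}`, as rational functions. -/
def chartCoord (X : ProjVariety N) (j l : Fin (N + 1)) (hj : MvPolynomial.X j ∉ X.ideal) :
    X.functionField :=
  ⟨X.toConeField (MvPolynomial.X l) / X.toConeField (MvPolynomial.X j),
    1, MvPolynomial.X l, MvPolynomial.X j, isHomogeneous_X _ _, isHomogeneous_X _ _, hj, hj, rfl⟩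

lemma coe_aeval_chartCoord (X : ProjVariety N) {j : Fin (N + 1)} (hj : MvPolynomial.X j ∉ X.ideal)
    {q : HomPoly N} {e : ℕ} (hq : q.IsHomogeneous e) :
    ((aeval (fun l => X.chartCoord j l hj) q : X.functionField) : X.coneField) =
      X.toConeField q / X.toConeField (MvPolynomial.X j) ^ e := by
  have h := comp_aeval_apply (R := ℂ) (f := fun l => X.chartCoord j l hj) X.functionField.val q
  refine h.trans ?_
  have h1 : (fun l => X.functionField.val (X.chartCoord j l hj)) = fun l =>
      (X.toConeField (MvPolynomial.X j))⁻¹ * X.toConeField (MvPolynomial.X l) :=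
    funext fun l => div_eq_inv_mul _ _
  rw [h1, aeval_mul_left_of_isHomogeneous hq, ← toConeField_eq_aeval, inv_pow, div_eq_inv_mul]

/-- A nonzero rational section of a power of the anticanonical sheaf of a smooth complete
intersection of index one, as a form on the cone. -/
lemma exists_form_of_section {M k : ℕ} {d : Fin k → ℕ} {f : Fin k → HomPoly (M + k)}
    {F : ProjVariety (M + k)} (hd : ∀ i, 2 ≤ d i) (hsum : ∑ i, d i = M + k)
    (hf : ∀ i, (f i).IsHomogeneous (d i)) (hsmooth : IsSmoothCI f)
    (hfF : ∀ i, f i ∈ F.ideal) (W : ProjVariety (M + k)) {n : ℕ} {s : F.RatAnticanonical M n}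
    (hs : s ≠ 0) :
    ∃ g : F.prodField W, g ≠ 0 ∧ ∀ (Z : ProjVariety (M + k)) (m : ℕ),
      Z.carrier ⊆ F.carrier → F.VanishesToOrder Z s m →
      ∀ (j : Fin (M + k + 1)) (l : Fin M → Fin (M + k + 1)), X j ∉ Z.ideal →
        ∃ q ∈ F.maxIdealAlong Z ^ m,
          aeval (F.genFst W) (jacDet f (X : _ → HomPoly (M + k)) j l) ^ n * g =
            F.genFst W j ^ ((M + 1) * n) * F.fstHom W (q : F.functionField) := by
  obtain ⟨v, hv⟩ := F.affineCone_nonempty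
  obtain ⟨j₀, hvj⟩ := Function.ne_iff.mp hv.1
  have hj₀ : (X j₀ : HomPoly (M + k)) ∉ F.ideal := fun h => hvj (by
    simpa using mem_ideal.mp h v hv)
  have hX : ∀ {j}, (X j : HomPoly (M + k)) ∉ F.ideal → F.toConeField (X j) ≠ 0 :=
    fun h h0 => h (toConeField_eq_zero.mp h0)
  let z : Fin (M + k + 1) → F.functionField := fun l => F.chartCoord j₀ l hj₀
  have hz : ∀ l, ((z l : F.functionField) : F.coneField) =
      F.toConeField (X l) / F.toConeField (X j₀) := fun l => rfl
  have hzf : ∀ i, aeval z (f i) = 0 := fun i => Subtype.ext (by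
    rw [coe_aeval_chartCoord F hj₀ (hf i), toConeField_eq_zero.mpr (hfF i), zero_div]
    rfl)
  have hzj₀ : z j₀ = 1 := Subtype.ext (div_self (hX hj₀))
  have hgen : ∀ a : F.functionField, ∃ p q : HomPoly (M + k), a = aeval z p / aeval z q := by
    intro a
    obtain ⟨m, p, q, hp, hq, hqF, -, ha⟩ := a.2
    refine ⟨p, q, Subtype.ext ?_⟩
    refine Eq.trans ha ?_
    rw [IntermediateField.coe_div, coe_aeval_chartCoord F hj₀ hp, coe_aeval_chartCoord F hj₀ hq]
    have := pow_ne_zero m (hX hj₀)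
    field_simp
  obtain ⟨h, hh0, hh⟩ := RatSections.exists_onWedges_eq hf hsmooth hzf hzj₀ hgen hs
  -- The coefficient `h` is taken relative to the residue form normalized by `z j₀ = 1`; the factor
  -- `x_{j₀}^n` homogenizes it to degree `n`.
  refine ⟨F.genFst W j₀ ^ n * F.fstHom W (h : F.coneField), ?_, ?_⟩
  · have h1 : F.genFst W j₀ ≠ 0 := fun h0 => hj₀ (aeval_genFst_eq_zero (Z := W).mp (by
      rw [aeval_X]; exact h0))
    refine mul_ne_zero (pow_ne_zero _ h1) ?_
    rw [Ne, map_eq_zero]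
    exact fun h0 => hh0 (Subtype.ext h0)
  · intro Z m hZF hvan j l hjZ
    have hjF : (X j : HomPoly (M + k)) ∉ F.ideal := fun h => hjZ (ideal_le_ideal hZF h)
    have hzj : z j ≠ 0 := fun h0 => div_ne_zero (hX hjF) (hX hj₀) (congrArg Subtype.val h0)
    have hdiv : ∀ l, (((z l / z j : F.functionField)) : F.coneField) =
        F.toConeField (X l) / F.toConeField (X j) := by
      intro l
      rw [IntermediateField.coe_div, hz, hz, div_div_div_cancel_right₀ (hX hj₀)]
    -- The vanishing condition is tested on the regular functions `x_l / x_j` of a chart meeting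
    -- `Z`.
    obtain ⟨q, hq, hqs⟩ := hvan fun _ r => ⟨z (l r) / z j, 1, X (l r), X j, isHomogeneous_X _ _,
      isHomogeneous_X _ _, hjF, hjZ, hdiv (l r)⟩
    refine ⟨q, hq, ?_⟩
    have h1 := hqs.trans (hh j l hzj)
    have h2 : ((q : F.functionField) : F.coneField) =
        (F.toConeField (jacDet f (X : _ → HomPoly (M + k)) j l) / F.toConeField (X j₀) ^ M *
          ((F.toConeField (X j) / F.toConeField (X j₀)) ^ (M + 1))⁻¹) ^ n * h := by
      rw [h1, ← aeval_jacDet_X]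
      push_cast
      rw [coe_aeval_chartCoord F hj₀ (isHomogeneous_jacDet hf hd hsum j l), hz]
    have hj1 := hX hjF
    have hj2 := hX hj₀
    have h3 : F.toConeField (jacDet f (X : _ → HomPoly (M + k)) j l) ^ n *
        (F.toConeField (X j₀) ^ n * h) =
        F.toConeField (X j) ^ ((M + 1) * n) * ((q : F.functionField) : F.coneField) := by
      rw [h2, pow_mul, ← mul_assoc, ← mul_assoc, ← mul_pow, ← mul_pow]
      congr 2
      rw [div_pow, inv_div, pow_succ (F.toConeField (X j₀))]
      field_simp
    have h4 := congrArg (F.fstHom W) h3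
    simp only [map_mul, map_pow, fstHom_toConeField, aeval_X] at h4
    exact h4

end ProjVariety

/-- The multiplicity of a nonzero pluri-anticanonical section along a subvariety of dimension
`k`. -/
theorem IsFanoCompleteIntersection.le_of_vanishesToOrder {k M : ℕ} (hk : 0 < k) {d : Fin k → ℕ}
    {f : Fin k → HomPoly (M + k)} {F : ProjVariety (M + k)}
    (hF : IsFanoCompleteIntersection k M d f F) (hsmooth : IsSmoothCI f) {n m : ℕ}
    {s : F.RatAnticanonical M n} (hs : s ≠ 0) (hreg : s ∈ F.anticanonicalSections M n)
    {Y : ProjVariety (M + k)} (hYF : Y.carrier ⊆ F.carrier) (hY : Y.HasDim k)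
    (hm : F.VanishesToOrder Y s m) : m ≤ n := by
  have hf := hF.isHomogeneous
  have hfF : ∀ i, f i ∈ F.ideal := fun i => by
    rw [ProjVariety.mem_ideal]
    rintro v ⟨hv, hvF⟩
    rw [hF.carrier_eq] at hvF
    exact eval_eq_zero_of_rep (hf i) hv (hvF _ ⟨i, rfl⟩)
  have hfY : ∀ i, f i ∈ Y.ideal := fun i => ProjVariety.ideal_le_ideal hYF (hfF i)
  have hdet : ∀ v ∈ affineCone F.carrier, ∃ (j : Fin (M + k + 1)) (l : Fin M → Fin (M + k + 1)),
      v j ≠ 0 ∧ eval v (jacDet f (X : _ → HomPoly (M + k)) j l) ≠ 0 := by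
    intro v hv
    obtain ⟨j, hj⟩ := Function.ne_iff.mp hv.1
    obtain ⟨l, hl⟩ := exists_jacDet_ne_zero hf hsmooth
      (fun i => ProjVariety.mem_ideal.mp (hfF i) v hv) hj
    refine ⟨j, l, hj, ?_⟩
    rwa [← aeval_eq_eval, aeval_jacDet_X]
  have hjac := isHomogeneous_jacDet hf hF.two_le_degree hF.sum_degree
  have hfil : ∀ {q : HomPoly (M + k)} {e : ℕ}, q.IsHomogeneous e → aeval (F.genFst Y) q ∈
      degFil (F.diffField Y) (F.genSnd Y) e := fun h => aeval_mem_degFil (F.genFst_mem_degFil Y) h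
  obtain ⟨g, hg0, hg⟩ := ProjVariety.exists_form_of_section hF.two_le_degree hF.sum_degree hf
    hsmooth hfF Y hs
  -- The admissible denominators of `g` have no common zero on `F`: regularity at each closed point
  -- supplies one that is nonzero there. Hence a power of every coordinate is a denominator, with
  -- numerator of the expected degree.
  obtain ⟨r, hr⟩ := F.exists_forall_X_pow_mem_span {b | ∃ e : ℕ, b.IsHomogeneous e ∧
    aeval (F.genFst Y) b * g ∈ degFil (F.diffField Y) (F.genSnd Y) (e + n)} (by
      rintro v hv
      obtain ⟨hv0, hvF⟩ := id hv
      let Z := ProjVariety.point (Projectivization.mk ℂ v hv0)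
      have hZF : Z.carrier ⊆ F.carrier := by rintro _ rfl; exact hvF
      have hvZ : v ∈ affineCone Z.carrier := ⟨hv0, rfl⟩
      obtain ⟨j, l, hj, hl⟩ := hdet v hv
      obtain ⟨q, -, hq⟩ := hg Z 0 hZF (hreg Z hZF) j l fun h => hj (by
        simpa using ProjVariety.mem_ideal.mp h v hvZ)
      obtain ⟨e, a, b, ha, hb, hbZ, hab⟩ := ProjVariety.exists_mul_eq_of_localRing Y q
      refine ⟨b * jacDet f (X : _ → HomPoly (M + k)) j l ^ n,
        ⟨e + M * n, hb.mul ((hjac j l).pow n), ?_⟩, ?_⟩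
      · have h1 : aeval (F.genFst Y) (b * jacDet f (X : _ → HomPoly (M + k)) j l ^ n) * g =
            aeval (F.genFst Y) (X j ^ ((M + 1) * n) * a) := by
          rw [map_mul, map_mul, map_pow, mul_assoc, hq, ← hab, map_pow, aeval_X]
          ring
        rw [h1]
        refine degFil_mono _ ?_ (hfil (((isHomogeneous_X ℂ j).pow _).mul ha))
        push_cast
        linarith
      · rw [map_mul, map_pow]
        refine mul_ne_zero (fun h0 => hbZ ?_) (pow_ne_zero _ hl)
        rw [ProjVariety.mem_ideal]
        rintro w ⟨hw0, hw⟩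
        obtain ⟨t, ht⟩ := (Projectivization.mk_eq_mk_iff' ℂ _ _ hw0 hv0).mp hw
        rw [← ht, eval_smul_of_isHomogeneous hb, h0, mul_zero])
  have hreg' : ∀ j, F.genFst Y j ^ r * g ∈ degFil (F.diffField Y) (F.genSnd Y) (r + n) := by
    intro j
    let ev : HomPoly (M + k) →+ F.prodField Y :=
      (AddMonoidHom.mulRight g).comp (aeval (F.genFst Y)).toRingHom.toAddMonoidHom
    have key := map_homogeneousComponent_mem_of_mem_span ev
      (fun e => (degFil (F.diffField Y) (F.genSnd Y) (e + n)).toAddSubgroup) _ (by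
        rintro q (⟨hq, e, he⟩ | ⟨e, he, hqg⟩)
        · refine ⟨e, he, fun d₁ c _ => ?_⟩
          change aeval (F.genFst Y) (c * q) * g ∈ degFil _ _ _
          rw [map_mul, ProjVariety.aeval_genFst_eq_zero.mpr hq, mul_zero, zero_mul]
          exact zero_mem _
        · refine ⟨e, he, fun d₁ c hc => ?_⟩
          change aeval (F.genFst Y) (c * q) * g ∈ degFil _ _ _
          rw [map_mul, mul_assoc]
          exact mul_mem_degFil_of_eq (hfil hc) hqg (by push_cast; linarith)) (hr j) r
    rw [homogeneousComponent_of_mem (by simpa using (isHomogeneous_X ℂ j).pow r), if_pos rfl] at key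
    have h1 : ev (X j ^ r) = F.genFst Y j ^ r * g := by
      change aeval (F.genFst Y) (X j ^ r) * g = _
      rw [map_pow, aeval_X]
    rw [h1] at key
    exact key
  obtain ⟨v, hv⟩ := Y.affineCone_nonempty
  have hvF : v ∈ affineCone F.carrier := ⟨hv.1, hYF hv.2⟩
  obtain ⟨j, l, hj, hl⟩ := hdet v hvF
  -- Near the chosen point of `Y`, `g` is `q` up to a power of `X j` and the `n`-th power of a
  -- Jacobian determinant. The form `Q` is this power times the denominator `b` of `q`.
  obtain ⟨q, hqm, hq⟩ := hg Y m hYF hm j l fun h => hj (by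
    simpa using ProjVariety.mem_ideal.mp h v hv)
  obtain ⟨δ, b, hb, hbY, hbq⟩ := F.maxIdealAlong_pow_le_filIdeal Y m hqm
  have hlY : jacDet f (X : _ → HomPoly (M + k)) j l ∉ Y.ideal :=
    fun h => hl (ProjVariety.mem_ideal.mp h v hv)
  refine ProjVariety.le_of_mul_mem_degFil hk hF.two_le_degree hf hF.ne_zero hsmooth hF.carrier_eq
    hF.hasDim hYF hY hfF hfY hg0 (Q := b * jacDet f (X : _ → HomPoly (M + k)) j l ^ n)
    (hb.mul ((hjac j l).pow n))
    (Y.isPrime_ideal.mul_notMem hbY fun h => hlY (Y.isPrime_ideal.mem_of_pow_mem n h)) ?_ hreg'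
  have h1 : aeval (F.genFst Y) (b * jacDet f (X : _ → HomPoly (M + k)) j l ^ n) * g =
      aeval (F.genFst Y) (X j ^ ((M + 1) * n) : HomPoly (M + k)) *
        (aeval (F.genFst Y) b * F.fstHom Y (q : F.functionField)) := by
    rw [map_mul, map_pow, mul_assoc, hq, map_pow, aeval_X]
    ring
  rw [h1]
  -- Degree count: `(M + 1) * n + δ - m = (δ + M * n) + n - m`, where `δ + M * n` is the degree of
  -- `Q`.
  refine mul_mem_degFil_of_eq (hfil ((isHomogeneous_X ℂ j).pow _)) hbq ?_
  push_cast
  linarith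

end

theorem lemma2p1 (k M : ℕ) (hk : 2 ≤ k) (hM : 2 * k + 1 ≤ M)
    (d : Fin k → ℕ) (f : Fin k → HomPoly (M + k)) (F : ProjVariety (M + k))
    (hF : IsFanoCompleteIntersection k M d f F)
    (hsmooth : IsSmoothCI f)
    (hregular : ∀ x ∈ F.carrier, IsRegularPoint d f x)
    (n : ℕ) (S : Submodule ℂ (F.RatAnticanonical M n))
    (hS : F.IsMovableSystem M n S)
    (Y : ProjVariety (M + k)) (hYF : Y.carrier ⊆ F.carrier) (hY : Y.HasDim k) :
    F.multSystem Y S ≤ (n : ℕ∞) := by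
  obtain ⟨s, hs, hs0⟩ := Submodule.exists_mem_ne_zero_of_ne_bot hS.ne_bot
  -- The multiplicity of the system is a minimum over its members, so any nonzero member bounds it.
  refine (iInf₂_le s hs).trans (iSup₂_le fun m hm => ?_)
  exact_mod_cast hF.le_of_vanishesToOrder (by omega) hsmooth hs0 (hS.le hs) hYF hY hm
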